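/- Let $N\ge 2$, let $A_1,\dots,A_{2^N-2}$ be an enumeration of the non-empty proper subsets of $\{1,\dots,N\}$, and let $p_1,\dots,p_{2^N-2}$ be distinct prime numbers. For $j\in\{1,\dots,N\}$ put $$q_j=\prod_{\{n\,:\,j\in A_n\}}p_n,\qquad \phi_j(k)=q_jk\quad(k\in\mathbb N=\{1,2,\dots\}).$$ Terminology. A finite Borel measure $\rho$ on the circle $\mathbb T=\mathbb R/\mathbb Z$ is symmetric if $\int_{\mathbb T} e^{2\pi i nx}\,d\rho(x)=\int_{\mathbb T} e^{-2\pi i nx}\,d\rho(x)$ for all $n\in\mathbb Z$. The Gaussian measure associated with a symmetric finite $\rho$ is the Borel probability measure $\gamma$ on $\mathbb R^{\mathbb Z}$ such that, with $X_n(\omega)=\omega(n)$, every element of the closed real linear span of $\{X_n\}_{n\in\mathbb Z}$ in $L^2(\gamma)$ is a centred Gaussian random variable (the constant $0$ being allowed) and $\int X_nX_m\,d\gamma=\int_{\mathbb T}e^{2\pi i(m-n)x}\,d\rho(x)$ for all $m,n\in\mathbb Z$. With the shift $(T\omega)(n)=\omega(n+1)$ and the Borel $\sigma$-algebra $\mathcal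 A$ of $\mathbb R^{\mathbb Z}$, $(\mathbb R^{\mathbb Z},\mathcal A,\gamma,T)$ is a Gaussian system; it is non-trivial if $\rho\ne0$. A measure preserving transformation $T$ of a probability space $(X,\mathcal F,\nu)$ is weakly mixing if $\lim_{M\to\infty}\frac1M\sum_{n=1}^M|\nu(A\cap T^{-n}B)-\nu(A)\nu(B)|=0$ for all $A,B\in\mathcal F$, and it is aperiodic if $\nu(\{x:\exists n\ge1,\ T^nx=x\})=0$. Then there is a strictly increasing sequence $(n_k)_{k\in\mathbb N}$ in $\mathbb N$ such that for every $\vec\xi=(\xi_1,\dots,\xi_N)\in\{0,1\}^N$ the following two assertions hold. (a) There is a non-trivial weakly mixing Gaussian system $(\mathbb R^{\mathbb Z},\mathcal A,\gamma_{\vec\xi},T_{\vec\xi})$ such that for every $j\in\{1,\dots,N\}$ and all $A,B\in\mathcal A$, $$\lim_{k\to\infty}\gamma_{\vec\xi}(A\cap T_{\vec\xi}^{-\phi_j(n_k)}B)=(1-\xi_j)\gamma_{\vec\xi}(A\cap B)+\xi_j\gamma_{\vec\xi}(A)\gamma_{\vec\xi}(B).$$ (b) There is an aperiodic invertible transformation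 $S_{\vec\xi}$ of $[0,1]$ preserving Lebesgue measure $\mu$ such that for every $j\in\{1,\dots,N\}$ and all Borel sets $A,B\subseteq[0,1]$, $$\lim_{k\to\infty}\mu(A\cap S_{\vec\xi}^{-\phi_j(n_k)}B)=(1-\xi_j)\mu(A\cap B)+\xi_j\mu(A)\mu(B).$$ In particular $\phi_1,\dots,\phi_N$ satisfy Condition C, that is, there is a strictly increasing sequence $(n_k)$ in $\mathbb N$ for which (b) holds for all $\vec\xi\in\{0,1\}^N$. On the other hand, $\phi_1,\dots,\phi_N$ are not asymptotically independent: it is not true that $\lim_{k\to\infty}\bigl|\sum_{j=1}^Na_j\phi_j(k)\bigr|=\infty$ for every $(a_1,\dots,a_N)\in\mathbb Z^N\setminus\{0\}$. -/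

import Mathlib

open MeasureTheory ProbabilityTheory Filter Topology
open scoped NNReal

namespace CondC

noncomputable section

/-- The (possibly negative) power `T ^ a` of an invertible measurable transformation. -/
def power {X : Type*} [MeasurableSpace X] (T : X ≃ᵐ X) (a : ℤ) : X → X :=
  ⇑((T.toEquiv : Equiv.Perm X) ^ a)

/-- For all measurable `A, B`: `ν (A ∩ T^{-a_k} B) → (1 - ξ) ν (A ∩ B) + ξ ν(A) ν(B)`.
For `ξ = 0` this is rigidity of `T` along `(a_k)`, for `ξ = 1` it is the mixing property
along `(a_k)`. -/
def LimitAlong {X : Type*} [MeasurableSpace X] (ν : Measure X) (T : X ≃ᵐ X)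
    (a : ℕ → ℤ) (ξ : ℝ) : Prop :=
  ∀ A B : Set X, MeasurableSet A → MeasurableSet B →
    Tendsto (fun k => ν.real (A ∩ power T (a k) ⁻¹' B)) atTop
      (𝓝 ((1 - ξ) * ν.real (A ∩ B) + ξ * (ν.real A * ν.real B)))

/-- A measure preserving transformation that is weakly mixing: the Cesàro averages of
`|ν (A ∩ T^{-n} B) - ν(A) ν(B)|` over `1 ≤ n ≤ M` tend to `0`. -/
def WeaklyMixing {X : Type*} [MeasurableSpace X] (ν : Measure X) (T : X ≃ᵐ X) : Prop :=
  MeasurePreserving T ν ν ∧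
  ∀ A B : Set X, MeasurableSet A → MeasurableSet B →
    Tendsto (fun M : ℕ => (1 / (M : ℝ)) * ∑ n ∈ Finset.Icc 1 M,
      |ν.real (A ∩ power T (n : ℤ) ⁻¹' B) - ν.real A * ν.real B|) atTop (𝓝 0)

/-- The set of periodic points is a null set. -/
def Aperiodic {X : Type*} [MeasurableSpace X] (ν : Measure X) (T : X ≃ᵐ X) : Prop :=
  ν {x | ∃ n : ℕ, 1 ≤ n ∧ power T (n : ℤ) x = x} = 0

/-- The shift `(T ω)(n) = ω (n + 1)` on `ℝ^ℤ`. -/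
def shift : (ℤ → ℝ) ≃ᵐ (ℤ → ℝ) where
  toFun ω n := ω (n + 1)
  invFun ω n := ω (n - 1)
  left_inv ω := by funext n; simp
  right_inv ω := by funext n; simp
  measurable_toFun := measurable_pi_lambda _ fun n => measurable_pi_apply (n + 1)
  measurable_invFun := measurable_pi_lambda _ fun n => measurable_pi_apply (n - 1)

/-- A measure on the circle `ℝ / ℤ` is symmetric if its `n`-th and `-n`-th Fourier coefficients
agree for all `n`. Here `fourier n x = exp (2 π i n x)`. -/
def SymmetricMeasure (ρ : Measure UnitAddCircle) : Prop :=
  ∀ n : ℤ, ∫ x, fourier n x ∂ρ = ∫ x, fourier (-n) x ∂ρ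

/-- The closed real linear span, in `L²(γ)`, of the coordinate projections `X_n ω = ω n`. -/
def firstChaos (γ : Measure (ℤ → ℝ)) : Submodule ℝ (Lp ℝ 2 γ) :=
  (Submodule.span ℝ {f : Lp ℝ 2 γ | ∃ n : ℤ, f =ᵐ[γ] fun ω => ω n}).topologicalClosure

/-- `γ` is the Gaussian measure on `ℝ^ℤ` associated with the spectral measure `ρ`: it is a
probability measure, the coordinates are square integrable, every element of their closed span
in `L²(γ)` is a centred Gaussian (possibly of variance zero), and the correlations of the
coordinates are the Fourier coefficients of `ρ`. -/
structure IsGaussianMeasure (ρ : Measure UnitAddCircle) (γ : Measure (ℤ → ℝ)) : Prop where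
  isProbabilityMeasure : IsProbabilityMeasure γ
  memLp : ∀ n : ℤ, MemLp (fun ω : ℤ → ℝ => ω n) 2 γ
  gaussian : ∀ f ∈ firstChaos γ, ∃ v : ℝ≥0, γ.map f = gaussianReal 0 v
  correlation : ∀ m n : ℤ,
    ((∫ ω, ω n * ω m ∂γ : ℝ) : ℂ) = ∫ x, fourier (m - n) x ∂ρ

/-- `(ℝ^ℤ, γ, shift)` is a non-trivial Gaussian system: `γ` is the Gaussian measure of a nonzero
finite symmetric Borel measure on the circle. -/
def IsNontrivialGaussianSystem (γ : Measure (ℤ → ℝ)) : Prop :=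
  ∃ ρ : Measure UnitAddCircle,
    IsFiniteMeasure ρ ∧ SymmetricMeasure ρ ∧ ρ ≠ 0 ∧ IsGaussianMeasure ρ γ

/-- Strictly increasing sequences of positive integers. -/
def IsIncreasingSeq (n : ℕ → ℕ) : Prop :=
  StrictMono n ∧ ∀ k, 0 < n k

/-- The sequence `(n_k)` witnesses Condition C for `φ_1, …, φ_N`: for every `ξ ∈ {0,1}^N` there is
an aperiodic invertible Lebesgue measure preserving transformation of `[0,1]` which has the limit
prescribed by `ξ_j` along `φ_j(n_k)` for each `j`. -/
def WitnessesConditionC {N : ℕ} (φ : Fin N → ℕ → ℤ) (n : ℕ → ℕ) : Prop :=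
  ∀ ξ : Fin N → Fin 2, ∃ T : Set.Icc (0 : ℝ) 1 ≃ᵐ Set.Icc (0 : ℝ) 1,
    MeasurePreserving T volume volume ∧ Aperiodic volume T ∧
    ∀ j, LimitAlong volume T (fun k => φ j (n k)) ((ξ j : ℕ) : ℝ)

/-- Condition C: some increasing sequence of positive integers witnesses it. -/
def ConditionC {N : ℕ} (φ : Fin N → ℕ → ℤ) : Prop :=
  ∃ n : ℕ → ℕ, IsIncreasingSeq n ∧ WitnessesConditionC φ n

/-- Asymptotic (linear) independence of integer sequences. -/
def AsymptoticallyIndependent {N : ℕ} (φ : Fin N → ℕ → ℤ) : Prop :=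
  ∀ a : Fin N → ℤ, a ≠ 0 → Tendsto (fun k => |∑ j, a j * φ j k|) atTop atTop

end

end CondC

-- Every pattern `ξ` is realised by a Gaussian system whose spectral measure `σ` is built from
-- independent digits, along one sequence `n_k = 2 (2P)^k k!` with `P = ∏ p_i`.
--
-- Fix `m ≥ 2` and integers `M_k` whose ratios `s_k = M_{k+1} / M_k` are multiples of `m` tending to
-- infinity. Let `σ` be the law modulo one of `x = ∑ a_i / (m M_i)`, with independent uniform digits
-- `a_i ∈ {0, …, m - 1}`. Modulo one, `M_k x` is `a_k / m` up to `2 / s_k`, so the Fourier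
-- coefficient of `σ` at `l + Q M_k` is close to the expectation of `e(l x) e(Q a_k / m)`. If `m ∣
-- Q`, the second factor is `1` and the limit is the coefficient at `l`. Otherwise the second factor
-- has mean zero and is asymptotically independent of the first, so the limit is `0`
-- (`exists_measure_fourier_limits`). Thus divisibility of `Q` by `m` decides between rigidity and
-- mixing.
--
-- Given `ξ`, let `S` be the set of `j` with `ξ_j = 0`. If `S` is non-empty and proper, then `S =
-- A_i` for some `i`, and `m = p_i` divides `q_j` exactly when `j ∈ S`. If `S` is empty, `m = 2P`
-- exceeds every `q_j`. If `S` is everything, `m = 2` works because of the leading factor `2` of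
-- `n_k`.
--
-- The Gaussian process with covariance `Re σ̂` inherits these limits: the characters `exp (i ∑ t_n
-- ω_n)` span a dense subspace of `L²`, and their correlations are exponentials of covariances
-- (`IsGaussianLawOf.nullOnAverage`). Since `σ` has no atoms, Wiener's lemma gives weak mixing, and
-- non-degeneracy gives aperiodicity. An isomorphism modulo null sets with Lebesgue measure carries
-- the system to `[0,1]`. Asymptotic independence fails because the `φ_j` are proportional to each
-- other.

universe u

/-! ### Gaussian processes with prescribed covariances -/

section GaussianConstruction

variable {Ω : Type*} [MeasurableSpace Ω] {P : Measure Ω} [IsProbabilityMeasure P]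

theorem integral_norm_le_norm_lp_two (f : Lp ℝ 2 P) : ∫ ω, ‖f ω‖ ∂P ≤ ‖f‖ := by
  rw [integral_norm_eq_lintegral_enorm (Lp.aestronglyMeasurable f), ← eLpNorm_one_eq_lintegral_enorm,
    Lp.norm_def]
  exact ENNReal.toReal_mono (Lp.eLpNorm_ne_top f)
    (eLpNorm_le_eLpNorm_of_exponent_le one_le_two (Lp.aestronglyMeasurable f))

theorem norm_cexp_mul_I_sub_le (a b : ℝ) :
    ‖Complex.exp (a * Complex.I) - Complex.exp (b * Complex.I)‖ ≤ |a - b| := by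
  have h : Complex.exp (a * Complex.I) - Complex.exp (b * Complex.I)
      = Complex.exp (b * Complex.I) * (Complex.exp (Complex.I * ((a - b : ℝ) : ℂ)) - 1) := by
    rw [mul_sub, ← Complex.exp_add, mul_one]
    congr 2
    push_cast
    ring
  rw [h, norm_mul, Complex.norm_exp_ofReal_mul_I, one_mul]
  exact Real.norm_exp_I_mul_ofReal_sub_one_le

omit [IsProbabilityMeasure P] in
theorem charFun_map_lp (f : Lp ℝ 2 P) (t : ℝ) :
    charFun (P.map f) t = ∫ ω, Complex.exp (t * f ω * Complex.I) ∂P := by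
  rw [charFun_apply_real, integral_map (Lp.aestronglyMeasurable f).aemeasurable
    (by fun_prop)]

theorem integrable_cexp_mul_I {g : Ω → ℝ} (hg : AEStronglyMeasurable g P) :
    Integrable (fun ω => Complex.exp (g ω * Complex.I)) P := by
  refine Integrable.of_bound (C := 1) ?_ (ae_of_all _ fun ω => ?_)
  · exact (Complex.continuous_exp.comp_aestronglyMeasurable
      ((Complex.continuous_ofReal.comp_aestronglyMeasurable hg).mul_const _))
  · rw [Complex.norm_exp_ofReal_mul_I]

theorem continuous_charFun_map_lp (t : ℝ) :
    Continuous fun f : Lp ℝ 2 P => charFun (P.map f) t := by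
  have key : LipschitzWith (‖t‖₊) fun f : Lp ℝ 2 P => charFun (P.map f) t := by
    refine LipschitzWith.of_dist_le_mul fun f g => ?_
    rw [dist_eq_norm, dist_eq_norm, charFun_map_lp, charFun_map_lp]
    have hint (f : Lp ℝ 2 P) : Integrable (fun ω => Complex.exp (t * f ω * Complex.I)) P := by
      have := integrable_cexp_mul_I (g := fun ω => t * f ω)
        ((Lp.aestronglyMeasurable f).const_mul t)
      simpa using this
    rw [← integral_sub (hint f) (hint g)]
    calc ‖∫ ω, (Complex.exp (t * f ω * Complex.I) - Complex.exp (t * g ω * Complex.I)) ∂P‖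
        ≤ ∫ ω, |t| * ‖(f - g) ω‖ ∂P := by
          refine norm_integral_le_of_norm_le
            (((Lp.memLp (f - g)).integrable one_le_two).norm.const_mul |t|) ?_
          filter_upwards [Lp.coeFn_sub f g] with ω hω
          rw [hω, Pi.sub_apply, Real.norm_eq_abs, ← abs_mul, mul_sub]
          simpa using norm_cexp_mul_I_sub_le (t * f ω) (t * g ω)
      _ = |t| * ∫ ω, ‖(f - g) ω‖ ∂P := integral_const_mul _ _
      _ ≤ ‖t‖₊ * ‖f - g‖ := by
          rw [coe_nnnorm, Real.norm_eq_abs]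
          exact mul_le_mul_of_nonneg_left (integral_norm_le_norm_lp_two _) (abs_nonneg t)
  exact key.continuous

/-- The variance is tied to the `L²` norm, so for each `t` the condition equates two continuous
functions of `f`; being centred Gaussian therefore survives `L²` limits. -/
theorem map_lp_eq_gaussianReal_iff (f : Lp ℝ 2 P) :
    P.map f = gaussianReal 0 (‖f‖₊ ^ 2) ↔
      ∀ t, charFun (P.map f) t = Complex.exp (-(‖f‖ ^ 2 * t ^ 2 / 2 : ℝ)) := by
  have h (t : ℝ) : charFun (gaussianReal 0 (‖f‖₊ ^ 2)) t
      = Complex.exp (-(‖f‖ ^ 2 * t ^ 2 / 2 : ℝ)) := by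
    rw [charFun_gaussianReal]
    simp
  refine ⟨fun H t => by rw [H, h], fun H => ?_⟩
  have : IsProbabilityMeasure (P.map f) :=
    Measure.isProbabilityMeasure_map (Lp.aestronglyMeasurable f).aemeasurable
  exact Measure.ext_of_charFun (funext fun t => by rw [H, h])

/-- The `L²` functions with a centred Gaussian law form a closed set. -/
theorem isClosed_setOf_map_eq_gaussianReal :
    IsClosed {f : Lp ℝ 2 P | P.map f = gaussianReal 0 (‖f‖₊ ^ 2)} := by
  simp_rw [map_lp_eq_gaussianReal_iff, Set.ofPred_forall]
  refine isClosed_iInter fun t => isClosed_eq (continuous_charFun_map_lp t) ?_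
  fun_prop

/-- The coordinates of an infinite product of standard Gaussians, as elements of `L²`. -/
noncomputable def stdCoord (ι : Type*) (i : ι) :
    Lp ℝ 2 (Measure.infinitePi fun _ : ι => gaussianReal 0 1) :=
  MemLp.toLp (fun ω => ω i) <|
    (memLp_id_gaussianReal 2).comp_measurePreserving
      (measurePreserving_eval_infinitePi (fun _ : ι => gaussianReal 0 1) i)

/-- Independence turns the characteristic function of the sum into a product of one-dimensional
Gaussian ones, and the exponents add up. -/
theorem map_sum_coord_infinitePi {ι : Type*} (s : Finset ι) (c : ι → ℝ) (t : ℝ) :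
    charFun ((Measure.infinitePi fun _ : ι => gaussianReal 0 1).map
      fun ω => ∑ i ∈ s, c i * ω i) t = Complex.exp (-((∑ i ∈ s, c i ^ 2) * t ^ 2 / 2 : ℝ)) := by
  have hind : iIndepFun (fun (i : s) (ω : ι → ℝ) => ω i)
      (Measure.infinitePi fun _ : ι => gaussianReal 0 1) :=
    (iIndepFun_infinitePi (P := fun _ : ι => gaussianReal 0 1) (X := fun _ x => x)
      (fun i => measurable_id)).precomp Subtype.val_injective
  have hm : Measurable fun ω : ι → ℝ => ∑ i ∈ s, c i * ω i :=
    Finset.measurable_fun_sum _ fun i _ => by fun_prop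
  rw [charFun_apply_real, integral_map hm.aemeasurable (by fun_prop)]
  have h1 (ω : ι → ℝ) : Complex.exp (t * (∑ i ∈ s, c i * ω i : ℝ) * Complex.I)
      = ∏ i : s, Complex.exp ((t * c i : ℝ) * (ω i : ℝ) * Complex.I) := by
    rw [Finset.prod_coe_sort s fun i => Complex.exp ((t * c i : ℝ) * (ω i : ℝ) * Complex.I),
      ← Complex.exp_sum]
    push_cast
    rw [Finset.mul_sum, Finset.sum_mul]
    congr 1
    exact Finset.sum_congr rfl fun i _ => by ring
  simp_rw [h1]
  rw [hind.integral_fun_prod_comp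
    (f := fun (i : s) (x : ℝ) => Complex.exp ((t * c i : ℝ) * (x : ℝ) * Complex.I))
    (fun i => (measurable_pi_apply _).aemeasurable) (fun i => by fun_prop)]
  have h2 (i : ι) : ∫ ω, Complex.exp ((t * c i : ℝ) * (ω i : ℝ) * Complex.I)
      ∂(Measure.infinitePi fun _ : ι => gaussianReal 0 1)
      = Complex.exp (-((c i) ^ 2 * t ^ 2 / 2 : ℝ)) := by
    have := charFun_gaussianReal (μ := 0) (v := 1) (t * c i)
    rw [charFun_apply_real, ← (measurePreserving_eval_infinitePi
      (fun _ : ι => gaussianReal 0 1) i).map_eq, integral_map (measurable_pi_apply i).aemeasurable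
      (by fun_prop)] at this
    refine this.trans ?_
    congr 1
    push_cast
    ring
  simp_rw [h2]
  rw [Finset.prod_coe_sort s fun i => Complex.exp (-((c i) ^ 2 * t ^ 2 / 2 : ℝ)),
    ← Complex.exp_sum]
  congr 1
  push_cast
  rw [Finset.sum_neg_distrib, Finset.sum_mul, Finset.sum_div]

theorem orthonormal_stdCoord (ι : Type*) : Orthonormal ℝ (stdCoord ι) := by
  classical
  rw [orthonormal_iff_ite]
  intro i j
  set P := Measure.infinitePi fun _ : ι => gaussianReal 0 1
  have hc (i : ι) : stdCoord ι i =ᵐ[P] fun ω => ω i := MemLp.coeFn_toLp _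
  have hX (i : ι) : MeasurePreserving (fun ω : ι → ℝ => ω i) P (gaussianReal 0 1) :=
    measurePreserving_eval_infinitePi (fun _ : ι => gaussianReal 0 1) i
  have h1 : inner ℝ (stdCoord ι i) (stdCoord ι j) = ∫ ω, ω i * ω j ∂P := by
    rw [L2.inner_def]
    refine integral_congr_ae ?_
    filter_upwards [hc i, hc j] with ω h2 h3
    rw [h2, h3]
    simp [mul_comm]
  rw [h1]
  split_ifs with hij
  · subst hij
    have h2 : ∫ x, x * x ∂(gaussianReal 0 1) = 1 := by
      have := variance_fun_id_gaussianReal (μ := 0) (v := 1)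
      rw [variance_of_integral_eq_zero (by fun_prop) integral_id_gaussianReal] at this
      simpa [sq] using this
    rw [← h2, ← (hX i).map_eq, integral_map (measurable_pi_apply i).aemeasurable (by fun_prop)]
  · have hind : IndepFun (fun ω : ι → ℝ => ω i) (fun ω => ω j) P :=
      (iIndepFun_infinitePi (P := fun _ : ι => gaussianReal 0 1) (X := fun _ x => x)
        (fun i => measurable_id)).indepFun hij
    rw [hind.integral_fun_mul_eq_mul_integral (measurable_pi_apply i).aestronglyMeasurable
      (measurable_pi_apply j).aestronglyMeasurable]
    have h2 : ∫ ω, ω i ∂P = 0 := by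
      have := integral_id_gaussianReal (μ := 0) (v := 1)
      rwa [← (hX i).map_eq, integral_map (measurable_pi_apply i).aemeasurable
        (by fun_prop)] at this
    rw [h2, zero_mul]

theorem map_sum_stdCoord {ι : Type*} (s : Finset ι) (c : ι → ℝ) :
    (Measure.infinitePi fun _ : ι => gaussianReal 0 1).map
      (∑ i ∈ s, c i • stdCoord ι i : Lp ℝ 2 (Measure.infinitePi fun _ : ι => gaussianReal 0 1))
    = gaussianReal 0 (‖∑ i ∈ s, c i • stdCoord ι i‖₊ ^ 2) := by
  rw [map_lp_eq_gaussianReal_iff]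
  intro t
  have h1 : (∑ i ∈ s, c i • stdCoord ι i :
      Lp ℝ 2 (Measure.infinitePi fun _ : ι => gaussianReal 0 1))
      =ᵐ[Measure.infinitePi fun _ : ι => gaussianReal 0 1] fun ω => ∑ i ∈ s, c i * ω i := by
    have h2 : ∀ᵐ ω ∂(Measure.infinitePi fun _ : ι => gaussianReal 0 1),
        ∀ i ∈ s, (c i • stdCoord ι i) ω = c i * ω i := by
      rw [Finset.eventually_all]
      intro i _
      filter_upwards [Lp.coeFn_smul (c i) (stdCoord ι i), MemLp.coeFn_toLp
        ((memLp_id_gaussianReal 2).comp_measurePreserving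
        (measurePreserving_eval_infinitePi (fun _ : ι => gaussianReal 0 1) i))] with ω h3 h4
      rw [h3, Pi.smul_apply, smul_eq_mul]
      congr 1
    filter_upwards [Lp.coeFn_finsetSum s fun i => c i • stdCoord ι i, h2] with ω h3 h4
    rw [h3, Finset.sum_apply]
    exact Finset.sum_congr rfl h4
  rw [Measure.map_congr h1, map_sum_coord_infinitePi]
  congr 5
  rw [← real_inner_self_eq_norm_sq, (orthonormal_stdCoord ι).inner_sum]
  simp [sq]

/-- Every real Hilbert space embeds isometrically into an `L²` space, with Gaussian image. -/
theorem exists_gaussian_linearIsometry (E : Type u) [NormedAddCommGroup E] [InnerProductSpace ℝ E]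
    [CompleteSpace E] : ∃ (Ω : Type u) (_ : MeasurableSpace Ω) (P : Measure Ω)
      (_ : IsProbabilityMeasure P) (J : E →ₗᵢ[ℝ] Lp ℝ 2 P),
      ∀ v, P.map (J v) = gaussianReal 0 (‖v‖₊ ^ 2) := by
  obtain ⟨w, b, hb⟩ := exists_hilbertBasis ℝ E
  have ho := (orthonormal_stdCoord w).orthogonalFamily
  let J : E →ₗᵢ[ℝ] Lp ℝ 2 (Measure.infinitePi fun _ : w => gaussianReal 0 1) :=
    ho.linearIsometry.comp b.repr.toLinearIsometry
  have hJ (i : w) : J (b i) = stdCoord w i := by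
    classical
    simp only [J, LinearIsometry.coe_comp, Function.comp_apply,
      LinearIsometryEquiv.coe_toLinearIsometry, HilbertBasis.repr_self]
    rw [ho.linearIsometry_apply_single]
    simp
  refine ⟨w → ℝ, inferInstance, Measure.infinitePi fun _ : w => gaussianReal 0 1, inferInstance,
    J, fun v => ?_⟩
  -- The vectors with the required law form a closed set containing the span of the Hilbert basis,
  -- which is dense.
  have hcl : IsClosed {v | (Measure.infinitePi fun _ : w => gaussianReal 0 1).map (J v)
      = gaussianReal 0 (‖J v‖₊ ^ 2)} :=
    isClosed_setOf_map_eq_gaussianReal.preimage J.continuous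
  have hv : v ∈ closure ((Submodule.span ℝ (Set.range b) : Submodule ℝ E) : Set E) := by
    rw [← Submodule.topologicalClosure_coe, b.dense_span]
    trivial
  have hsub : ((Submodule.span ℝ (Set.range b) : Submodule ℝ E) : Set E) ⊆
      {v | (Measure.infinitePi fun _ : w => gaussianReal 0 1).map (J v)
      = gaussianReal 0 (‖J v‖₊ ^ 2)} := by
    intro u hu
    rw [SetLike.mem_coe, Finsupp.mem_span_range_iff_exists_finsupp] at hu
    obtain ⟨c, rfl⟩ := hu
    have h1 : J (c.sum fun i a => a • b i) = ∑ i ∈ c.support, c i • stdCoord w i := by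
      simp_rw [Finsupp.sum, map_sum, map_smul, hJ]
    change Measure.map _ _ = _
    rw [h1]
    exact map_sum_stdCoord c.support c
  have := closure_minimal hsub hcl hv
  simpa using this

/-- `γ` is the law of a centred Gaussian process whose covariances are the inner products of the
vectors `v n`. -/
structure IsGaussianLawOf {E : Type*} [NormedAddCommGroup E] [InnerProductSpace ℝ E] (v : ℤ → E)
    (γ : Measure (ℤ → ℝ)) : Prop where
  isProbabilityMeasure : IsProbabilityMeasure γ
  map_linearCombination : ∀ t : ℤ →₀ ℝ, γ.map (fun ω => Finsupp.linearCombination ℝ ω t)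
    = gaussianReal 0 (‖Finsupp.linearCombination ℝ v t‖₊ ^ 2)

@[fun_prop]
theorem measurable_linearCombination (t : ℤ →₀ ℝ) :
    Measurable fun ω : ℤ → ℝ => Finsupp.linearCombination ℝ ω t := by
  simp_rw [Finsupp.linearCombination_apply, Finsupp.sum]
  exact Finset.measurable_fun_sum _ fun i _ => (measurable_pi_apply i).fun_const_smul (t i)

/-- The process is `J (v n)` for an isometry `J` onto a Gaussian subspace of some `L²(P)`, and `γ`
is its law. Linear combinations of the `J (v n)` are again values of `J`, hence Gaussian with the
right variance. -/
theorem exists_isGaussianLawOf {E : Type*} [NormedAddCommGroup E] [InnerProductSpace ℝ E]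
    [CompleteSpace E] (v : ℤ → E) : ∃ γ, IsGaussianLawOf v γ := by
  obtain ⟨Ω, _, P, _, J, hJ⟩ := exists_gaussian_linearIsometry E
  have hm (n : ℤ) : AEMeasurable (J (v n)) P := (Lp.aestronglyMeasurable _).aemeasurable
  have hX : AEMeasurable (fun ω n => J (v n) ω) P := aemeasurable_pi_lambda _ hm
  refine ⟨P.map fun ω n => J (v n) ω, Measure.isProbabilityMeasure_map hX, fun t => ?_⟩
  rw [AEMeasurable.map_map_of_aemeasurable (by fun_prop) hX, ← hJ]
  refine Measure.map_congr ?_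
  have h1 : J (Finsupp.linearCombination ℝ v t) = ∑ n ∈ t.support, t n • J (v n) := by
    simp_rw [Finsupp.linearCombination_apply, Finsupp.sum, map_sum, map_smul]
  have h2 : ∀ᵐ ω ∂P, ∀ n ∈ t.support, (t n • J (v n)) ω = t n • J (v n) ω := by
    rw [Finset.eventually_all]
    exact fun n _ => Lp.coeFn_smul _ _
  rw [h1]
  filter_upwards [Lp.coeFn_finsetSum t.support fun n => t n • J (v n), h2] with ω h3 h4
  rw [h3, Finset.sum_apply, Finset.sum_congr rfl h4, Function.comp_apply,
    Finsupp.linearCombination_apply, Finsupp.sum]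

end GaussianConstruction

/-! ### Convergence to zero on average -/

section Averages

/-- The averages of `‖f n‖` over the finite sets `F M` tend to zero. -/
def NullOnAverage {G : Type*} [NormedAddCommGroup G] (F : ℕ → Finset ℕ) (f : ℕ → G) : Prop :=
  Tendsto (fun M => ((F M).card : ℝ)⁻¹ * ∑ n ∈ F M, ‖f n‖) atTop (𝓝 0)

variable {G G' : Type*} [NormedAddCommGroup G] [NormedAddCommGroup G'] {F : ℕ → Finset ℕ}

theorem NullOnAverage.mono {f : ℕ → G} {g : ℕ → G'} (hg : NullOnAverage F g)
    (h : ∀ n, ‖f n‖ ≤ ‖g n‖) : NullOnAverage F f :=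
  squeeze_zero (fun M => by positivity) (fun M => by gcongr with n; exact h n) hg

theorem NullOnAverage.add {f g : ℕ → G} (hf : NullOnAverage F f) (hg : NullOnAverage F g) :
    NullOnAverage F fun n => f n + g n := by
  have h := Tendsto.add hf hg
  rw [add_zero] at h
  refine squeeze_zero (fun M => by positivity) (fun M => ?_) h
  rw [← mul_add, ← Finset.sum_add_distrib]
  gcongr
  exact norm_add_le _ _

theorem NullOnAverage.of_le_mul {f : ℕ → G} {g : ℕ → G'} (hg : NullOnAverage F g) (C : ℝ)
    (h : ∀ n, ‖f n‖ ≤ C * ‖g n‖) : NullOnAverage F f := by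
  have h' := Tendsto.const_mul C hg
  rw [mul_zero] at h'
  refine squeeze_zero (fun M => by positivity) (fun M => ?_) h'
  rw [mul_left_comm, Finset.mul_sum _ _ C]
  gcongr with n
  exact h n

theorem nullOnAverage_zero : NullOnAverage F fun _ => (0 : G) := by
  simp [NullOnAverage]

theorem NullOnAverage.sum {ι : Type*} {s : Finset ι} {f : ι → ℕ → G}
    (hf : ∀ i ∈ s, NullOnAverage F (f i)) : NullOnAverage F fun n => ∑ i ∈ s, f i n := by
  classical
  induction s using Finset.induction_on with
  | empty => simpa using nullOnAverage_zero
  | insert i s hi ih =>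
    simp_rw [Finset.sum_insert hi]
    exact (hf i (Finset.mem_insert_self i s)).add
      (ih fun j hj => hf j (Finset.mem_insert_of_mem hj))

/-- With one-point averaging sets the notion is ordinary convergence, so limits along a sequence and
the Cesàro averages of weak mixing share one argument. -/
theorem nullOnAverage_singleton {f : ℕ → G} :
    NullOnAverage (fun k => {k}) f ↔ Tendsto f atTop (𝓝 0) := by
  simpa [NullOnAverage] using tendsto_zero_iff_norm_tendsto_zero.symm

theorem NullOnAverage.of_approx {f : ℕ → G}
    (h : ∀ ε > 0, ∃ g : ℕ → G, NullOnAverage F g ∧ ∀ n, ‖f n‖ ≤ ε + ‖g n‖) :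
    NullOnAverage F f := by
  rw [NullOnAverage, Metric.tendsto_atTop]
  intro ε hε
  obtain ⟨g, hg, hfg⟩ := h (ε / 2) (half_pos hε)
  obtain ⟨N, hN⟩ := Metric.tendsto_atTop.1 hg (ε / 2) (half_pos hε)
  refine ⟨N, fun M hM => ?_⟩
  have h1 := hN M hM
  rw [Real.dist_0_eq_abs, abs_of_nonneg (by positivity)] at h1 ⊢
  have h2 : ((F M).card : ℝ)⁻¹ * ∑ n ∈ F M, ‖f n‖ ≤
      ((F M).card : ℝ)⁻¹ * ((F M).card * (ε / 2) + ∑ n ∈ F M, ‖g n‖) := by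
    gcongr
    calc ∑ n ∈ F M, ‖f n‖ ≤ ∑ n ∈ F M, (ε / 2 + ‖g n‖) := Finset.sum_le_sum fun n _ => hfg n
      _ = _ := by rw [Finset.sum_add_distrib, Finset.sum_const, nsmul_eq_mul]
  have h3 : ((F M).card : ℝ)⁻¹ * ((F M).card * (ε / 2)) ≤ ε / 2 := by
    rw [← mul_assoc]
    -- Only an inequality, since `F M` may be empty and the product is then `0`.
    have : ((F M).card : ℝ)⁻¹ * (F M).card ≤ 1 := inv_mul_le_one
    nlinarith
  rw [mul_add] at h2
  linarith

/-- For bounded functionals, convergence to zero on average on a set with dense span suffices. -/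
theorem nullOnAverage_of_dense {H : Type*} [NormedAddCommGroup H] [NormedSpace ℂ H]
    (L : ℕ → H →L[ℂ] ℂ) {K : ℝ} (hL : ∀ n, ‖L n‖ ≤ K) {D : Set H}
    (hD : (Submodule.span ℂ D).topologicalClosure = ⊤)
    (h : ∀ f ∈ D, NullOnAverage F fun n => L n f) (f : H) : NullOnAverage F fun n => L n f := by
  have hspan : ∀ f ∈ Submodule.span ℂ D, NullOnAverage F fun n => L n f := by
    intro f hf
    induction hf using Submodule.span_induction with
    | mem x hx => exact h x hx
    | zero => simpa using nullOnAverage_zero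
    | add x y _ _ hx hy => simpa using hx.add hy
    | smul a x _ hx => exact hx.of_le_mul ‖a‖ fun n => by simp
  have hK : 0 ≤ K := (norm_nonneg _).trans (hL 0)
  refine NullOnAverage.of_approx fun ε hε => ?_
  have hf : f ∈ closure ((Submodule.span ℂ D : Submodule ℂ H) : Set H) := by
    rw [← Submodule.topologicalClosure_coe, hD]
    trivial
  obtain ⟨g, hg, hfg⟩ := Metric.mem_closure_iff.1 hf (ε / (K + 1)) (by positivity)
  refine ⟨_, hspan g hg, fun n => ?_⟩
  have h1 : L n f = L n (f - g) + L n g := by simp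
  rw [h1]
  refine (norm_add_le _ _).trans (add_le_add_left ?_ _)
  refine ((L n).le_opNorm _).trans ?_
  rw [dist_eq_norm] at hfg
  calc ‖L n‖ * ‖f - g‖ ≤ K * (ε / (K + 1)) := by gcongr; exact hL n
    _ ≤ (K + 1) * (ε / (K + 1)) := by gcongr; linarith
    _ = ε := by field_simp

/-- Density is used once in each argument. In the conjugate-linear slot the inner product is flipped
first, which does not change its norm. -/
theorem nullOnAverage_inner_of_dense {H : Type*} [NormedAddCommGroup H] [InnerProductSpace ℂ H]
    (W : ℕ → H →L[ℂ] H) {K : ℝ} (hW : ∀ n, ‖W n‖ ≤ K) {D : Set H}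
    (hD : (Submodule.span ℂ D).topologicalClosure = ⊤)
    (h : ∀ f ∈ D, ∀ g ∈ D, NullOnAverage F fun n => inner ℂ f (W n g)) (f g : H) :
    NullOnAverage F fun n => inner ℂ f (W n g) := by
  have hK : 0 ≤ K := (norm_nonneg _).trans (hW 0)
  have h1 : ∀ g ∈ D, NullOnAverage F fun n => inner ℂ f (W n g) := by
    intro g hg
    refine NullOnAverage.mono (nullOnAverage_of_dense (fun n => innerSL ℂ (W n g))
      (K := K * ‖g‖) (fun n => ?_) hD (fun f hf => ?_) f) (fun n => ?_)
    · rw [innerSL_apply_norm]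
      exact (W n).le_of_opNorm_le (hW n) g
    · exact (h f hf g hg).mono fun n => by rw [innerSL_apply_apply, norm_inner_symm]
    · rw [innerSL_apply_apply, norm_inner_symm]
  refine NullOnAverage.mono (nullOnAverage_of_dense (fun n => (innerSL ℂ f).comp (W n))
    (K := ‖f‖ * K) (fun n => ?_) hD (fun g hg => ?_) g) (fun n => ?_)
  · refine (ContinuousLinearMap.opNorm_comp_le _ _).trans ?_
    rw [innerSL_apply_norm]
    gcongr
    exact hW n
  · exact h1 g hg
  · simp

end Averages

/-! ### Characters of `ℝ^ℤ` and their density in `L²` -/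

section Characters

/-- The character `ω ↦ exp (i ∑ t_n ω_n)` of `ℝ^ℤ`. -/
noncomputable def seqChar (t : ℤ →₀ ℝ) (ω : ℤ → ℝ) : ℂ :=
  Complex.exp (Finsupp.linearCombination ℝ ω t * Complex.I)

@[fun_prop]
theorem measurable_seqChar (t : ℤ →₀ ℝ) : Measurable (seqChar t) := by
  unfold seqChar
  fun_prop

theorem norm_seqChar (t : ℤ →₀ ℝ) (ω : ℤ → ℝ) : ‖seqChar t ω‖ = 1 :=
  Complex.norm_exp_ofReal_mul_I _

theorem seqChar_zero (ω : ℤ → ℝ) : seqChar 0 ω = 1 := by simp [seqChar]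

theorem conj_seqChar_mul (s t : ℤ →₀ ℝ) (ω : ℤ → ℝ) :
    starRingEnd ℂ (seqChar t ω) * seqChar s ω = seqChar (s - t) ω := by
  simp only [seqChar, ← Complex.exp_conj, ← Complex.exp_add, map_mul, Complex.conj_ofReal,
    Complex.conj_I, map_sub, Complex.ofReal_sub]
  congr 1
  ring

theorem conj_seqChar (t : ℤ →₀ ℝ) (ω : ℤ → ℝ) :
    starRingEnd ℂ (seqChar t ω) = seqChar (-t) ω := by
  simpa [seqChar_zero] using conj_seqChar_mul 0 t ω

theorem memLp_seqChar (γ : Measure (ℤ → ℝ)) [IsFiniteMeasure γ] (t : ℤ →₀ ℝ) :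
    MemLp (seqChar t) 2 γ :=
  MemLp.of_bound (by fun_prop) 1 (ae_of_all _ fun ω => (norm_seqChar t ω).le)

theorem ext_of_integral_seqChar {μ ν : Measure (ℤ → ℝ)} [IsFiniteMeasure μ] [IsFiniteMeasure ν]
    (h : ∀ t, ∫ ω, seqChar t ω ∂μ = ∫ ω, seqChar t ω ∂ν) : μ = ν := by
  let _ := TopologicalSpace.upgradeIsCompletelyMetrizable (ℤ → ℝ)
  -- With the discrete topology on the frequencies, joint continuity of the pairing reduces to
  -- continuity in `ω` for each fixed `t`.
  let _ : TopologicalSpace (ℤ →₀ ℝ) := ⊥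
  have : DiscreteTopology (ℤ →₀ ℝ) := ⟨rfl⟩
  let L : (ℤ → ℝ) →ₗ[ℝ] (ℤ →₀ ℝ) →ₗ[ℝ] ℝ := (Finsupp.lsum ℝ).toLinearMap ∘ₗ
      LinearMap.pi fun n => (LinearMap.lsmul ℝ ℝ).flip ∘ₗ LinearMap.proj n
  have hL (ω : ℤ → ℝ) (t : ℤ →₀ ℝ) : L ω t = Finsupp.linearCombination ℝ ω t := by
    simp only [L, Finsupp.linearCombination_apply, LinearMap.comp_apply, LinearEquiv.coe_coe,
      Finsupp.lsum_apply]
    exact Finsupp.sum_congr fun _ _ => by simp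
  refine ext_of_integral_char_eq (L := L) Real.continuous_probChar Real.probChar_ne_one
    (fun ω hω h0 => hω (funext fun n => ?_)) ?_ fun t => ?_
  · have := hL ω (Finsupp.single n 1)
    rw [h0] at this
    simpa using this.symm
  · rw [continuous_prod_of_discrete_right]
    intro t
    simp_rw [hL, Finsupp.linearCombination_apply, Finsupp.sum]
    fun_prop
  · convert h t using 3 with ω ω
    all_goals simp [BoundedContinuousFunction.char_apply, seqChar, hL, Real.probChar_apply]

/-- A real integrable function all of whose Fourier coefficients vanish is zero. -/
theorem ae_eq_zero_of_integral_mul_seqChar {γ : Measure (ℤ → ℝ)} [IsFiniteMeasure γ]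
    {h : (ℤ → ℝ) → ℝ} (hh : Integrable h γ) (h0 : ∀ t, ∫ ω, (h ω : ℂ) * seqChar t ω ∂γ = 0) :
    h =ᵐ[γ] 0 := by
  have key (g : (ℤ → ℝ) → ℝ) (hg : Integrable g γ) (t : ℤ →₀ ℝ) :
      ∫ ω, seqChar t ω ∂(γ.withDensity fun ω => ENNReal.ofReal (g ω))
      = ∫ ω, ((max (g ω) 0 : ℝ) : ℂ) * seqChar t ω ∂γ := by
    rw [integral_withDensity_eq_integral_toReal_smul₀ hg.aemeasurable.ennreal_ofReal
      (ae_of_all _ fun _ => ENNReal.ofReal_lt_top)]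
    simp [ENNReal.toReal_ofReal']
  have hint (g : (ℤ → ℝ) → ℝ) (hg : Integrable g γ) (t : ℤ →₀ ℝ) :
      Integrable (fun ω => ((max (g ω) 0 : ℝ) : ℂ) * seqChar t ω) γ := by
    refine Integrable.mul_bdd (c := 1) hg.pos_part.ofReal (by fun_prop)
      (ae_of_all _ fun ω => (norm_seqChar t ω).le)
  have hfin (g : (ℤ → ℝ) → ℝ) (hg : Integrable g γ) :
      IsFiniteMeasure (γ.withDensity fun ω => ENNReal.ofReal (g ω)) :=
    isFiniteMeasure_withDensity_ofReal hg.hasFiniteIntegral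
  have := hfin h hh
  have := hfin _ hh.neg
  -- The positive and negative parts of `h` are densities of finite measures with the same
  -- characteristic function. They agree almost everywhere, and since one of the two always
  -- vanishes, so does `h`.
  have heq : (γ.withDensity fun ω => ENNReal.ofReal (h ω))
      = γ.withDensity fun ω => ENNReal.ofReal ((-h) ω) := by
    refine ext_of_integral_seqChar fun t => ?_
    rw [key h hh, key _ hh.neg, ← sub_eq_zero, ← integral_sub (hint h hh t) (hint _ hh.neg t),
      ← h0 t]
    congr 1 with ω
    rw [← sub_mul, ← Complex.ofReal_sub, Pi.neg_apply]
    congr 2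
    rcases le_total (h ω) 0 with h1 | h1 <;> simp [h1]
  rw [withDensity_eq_iff hh.aemeasurable.ennreal_ofReal hh.neg.aemeasurable.ennreal_ofReal] at heq
  · filter_upwards [heq] with ω hω
    have h1 := congrArg ENNReal.toReal hω
    rw [ENNReal.toReal_ofReal', ENNReal.toReal_ofReal', Pi.neg_apply] at h1
    rcases le_total (h ω) 0 with h2 | h2
    · simpa [h2] using h1
    · simpa [h2] using h1
  · exact hh.lintegral_lt_top.ne

/-- Characters span a dense subspace of `L²`. -/
theorem span_seqChar_dense (γ : Measure (ℤ → ℝ)) [IsFiniteMeasure γ] :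
    (Submodule.span ℂ (Set.range fun t => (memLp_seqChar γ t).toLp)).topologicalClosure = ⊤ := by
  rw [Submodule.topologicalClosure_eq_top_iff, Submodule.eq_bot_iff]
  intro f hf
  have hint : Integrable f γ := (Lp.memLp f).integrable one_le_two
  have h1 (t : ℤ →₀ ℝ) : ∫ ω, f ω * seqChar t ω ∂γ = 0 := by
    have h2 := hf _ (Submodule.subset_span ⟨-t, rfl⟩)
    rw [L2.inner_def] at h2
    rw [← h2]
    refine integral_congr_ae ?_
    filter_upwards [(memLp_seqChar γ (-t)).coeFn_toLp] with ω hω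
    simp only [hω, RCLike.inner_apply, conj_seqChar, neg_neg]
  -- The conjugate of `f` is also orthogonal to all characters, so the real criterion applies to the
  -- real and imaginary parts separately.
  have h2 (t : ℤ →₀ ℝ) : ∫ ω, starRingEnd ℂ (f ω) * seqChar t ω ∂γ = 0 := by
    rw [← map_zero (starRingEnd ℂ), ← h1 (-t), ← integral_conj]
    simp_rw [map_mul, conj_seqChar, neg_neg]
  have hi1 (t : ℤ →₀ ℝ) : Integrable (fun ω => f ω * seqChar t ω) γ :=
    hint.mul_bdd (c := 1) (by fun_prop) (ae_of_all _ fun ω => (norm_seqChar t ω).le)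
  have hi2 (t : ℤ →₀ ℝ) : Integrable (fun ω => starRingEnd ℂ (f ω) * seqChar t ω) γ := by
    refine Integrable.mul_bdd (c := 1) ?_ (by fun_prop) (ae_of_all _ fun ω => (norm_seqChar t ω).le)
    exact (LinearIsometryEquiv.integrable_comp_iff Complex.conjLIE).2 hint
  have hre := ae_eq_zero_of_integral_mul_seqChar hint.re fun t => by
    have : ∀ ω, ((RCLike.re (f ω) : ℝ) : ℂ) * seqChar t ω
        = (1 / 2) * (f ω * seqChar t ω + starRingEnd ℂ (f ω) * seqChar t ω) := by
      intro ω
      rw [← add_mul, Complex.add_conj]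
      simp only [RCLike.re_to_complex]
      push_cast
      ring
    simp_rw [this]
    rw [integral_const_mul, integral_add (hi1 t) (hi2 t), h1, h2, add_zero, mul_zero]
  have him := ae_eq_zero_of_integral_mul_seqChar hint.im fun t => by
    have : ∀ ω, ((RCLike.im (f ω) : ℝ) : ℂ) * seqChar t ω
        = (-Complex.I / 2) * (f ω * seqChar t ω - starRingEnd ℂ (f ω) * seqChar t ω) := by
      intro ω
      rw [← sub_mul, Complex.sub_conj]
      simp only [RCLike.im_to_complex]
      push_cast
      linear_combination (((f ω).im : ℂ) * seqChar t ω) * Complex.I_sq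
    simp_rw [this]
    rw [integral_const_mul, integral_sub (hi1 t) (hi2 t), h1, h2, sub_zero, mul_zero]
  rw [Lp.eq_zero_iff_ae_eq_zero]
  filter_upwards [hre, him] with ω h3 h4
  exact Complex.ext h3 h4

end Characters

/-! ### Stationary Gaussian systems and their Koopman operators -/

section GaussianSystem

theorem power_shift_apply (a : ℤ) (ω : ℤ → ℝ) (n : ℤ) :
    CondC.power CondC.shift a ω n = ω (n + a) := by
  have h1 (ω : ℤ → ℝ) (n : ℤ) : (CondC.shift.toEquiv : Equiv.Perm (ℤ → ℝ)) ω n = ω (n + 1) := rfl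
  have h2 (ω : ℤ → ℝ) (n : ℤ) :
      (CondC.shift.toEquiv : Equiv.Perm (ℤ → ℝ))⁻¹ ω n = ω (n - 1) := rfl
  unfold CondC.power
  induction a using Int.induction_on generalizing ω n with
  | zero => simp
  | succ k ih =>
    rw [zpow_add_one, Equiv.Perm.mul_apply, ih, h1]
    congr 1
    ring
  | pred k ih =>
    rw [zpow_sub_one, Equiv.Perm.mul_apply, ih, h2]
    congr 1
    ring

@[fun_prop]
theorem measurable_power_shift (a : ℤ) : Measurable (CondC.power CondC.shift a) := by
  refine measurable_pi_lambda _ fun n => ?_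
  simp_rw [power_shift_apply]
  exact measurable_pi_apply _

/-- Translation of finitely supported sequences. -/
noncomputable def shiftFinsupp (a : ℤ) (t : ℤ →₀ ℝ) : ℤ →₀ ℝ := t.mapDomain (· + a)

theorem linearCombination_shiftFinsupp {E : Type*} [AddCommGroup E] [Module ℝ E] (v : ℤ → E) (a : ℤ)
    (t : ℤ →₀ ℝ) : Finsupp.linearCombination ℝ v (shiftFinsupp a t)
      = t.sum fun n c => c • v (n + a) := by
  rw [shiftFinsupp, Finsupp.linearCombination_mapDomain, Finsupp.linearCombination_apply]
  rfl

theorem seqChar_power_shift (a : ℤ) (t : ℤ →₀ ℝ) (ω : ℤ → ℝ) :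
    seqChar t (CondC.power CondC.shift a ω) = seqChar (shiftFinsupp a t) ω := by
  unfold seqChar
  rw [linearCombination_shiftFinsupp, Finsupp.linearCombination_apply]
  simp_rw [power_shift_apply]

variable {E : Type*} [NormedAddCommGroup E] [InnerProductSpace ℝ E] {v : ℤ → E}
  {γ : Measure (ℤ → ℝ)} {r : ℤ → ℝ}

theorem inner_linearCombination (hr : ∀ i j, inner ℝ (v i) (v j) = r (j - i)) (s t : ℤ →₀ ℝ) :
    inner ℝ (Finsupp.linearCombination ℝ v t) (Finsupp.linearCombination ℝ v s)
      = ∑ i ∈ t.support, ∑ j ∈ s.support, t i * s j * r (j - i) := by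
  simp_rw [Finsupp.linearCombination_apply, Finsupp.sum, sum_inner, inner_sum,
    real_inner_smul_left, real_inner_smul_right, hr, mul_assoc]

theorem inner_linearCombination_shiftFinsupp (hr : ∀ i j, inner ℝ (v i) (v j) = r (j - i))
    (a : ℤ) (s t : ℤ →₀ ℝ) :
    inner ℝ (Finsupp.linearCombination ℝ v t) (Finsupp.linearCombination ℝ v (shiftFinsupp a s))
      = ∑ i ∈ t.support, ∑ j ∈ s.support, t i * s j * r (j - i + a) := by
  simp_rw [linearCombination_shiftFinsupp, Finsupp.linearCombination_apply, Finsupp.sum, sum_inner,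
    inner_sum, real_inner_smul_left, real_inner_smul_right, hr, mul_assoc]
  refine Finset.sum_congr rfl fun i _ => Finset.sum_congr rfl fun j _ => ?_
  congr 3
  ring

theorem norm_linearCombination_shiftFinsupp (hr : ∀ i j, inner ℝ (v i) (v j) = r (j - i))
    (a : ℤ) (t : ℤ →₀ ℝ) : ‖Finsupp.linearCombination ℝ v (shiftFinsupp a t)‖
      = ‖Finsupp.linearCombination ℝ v t‖ := by
  have h : ‖Finsupp.linearCombination ℝ v (shiftFinsupp a t)‖ ^ 2
      = ‖Finsupp.linearCombination ℝ v t‖ ^ 2 := by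
    rw [← real_inner_self_eq_norm_sq, ← real_inner_self_eq_norm_sq,
      linearCombination_shiftFinsupp, inner_linearCombination hr]
    simp_rw [Finsupp.sum, sum_inner,
      inner_sum, real_inner_smul_left, real_inner_smul_right, hr, mul_assoc]
    refine Finset.sum_congr rfl fun i _ => Finset.sum_congr rfl fun j _ => ?_
    congr 3
    ring
  exact (sq_eq_sq₀ (norm_nonneg _) (norm_nonneg _)).1 h

theorem IsGaussianLawOf.integral_seqChar (h : IsGaussianLawOf v γ) (t : ℤ →₀ ℝ) :
    ∫ ω, seqChar t ω ∂γ = Complex.exp (-(‖Finsupp.linearCombination ℝ v t‖ ^ 2 / 2 : ℝ)) := by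
  have h1 := charFun_gaussianReal (μ := 0) (v := ‖Finsupp.linearCombination ℝ v t‖₊ ^ 2) 1
  rw [charFun_apply_real, ← h.map_linearCombination, integral_map (by fun_prop) (by fun_prop)] at h1
  simpa [seqChar] using h1

/-- Stationarity keeps the norm of `∑ t_n v_n` under translation of `t`; these norms determine the
characteristic function of `γ`. -/
theorem IsGaussianLawOf.measurePreserving_power (h : IsGaussianLawOf v γ)
    (hr : ∀ i j, inner ℝ (v i) (v j) = r (j - i)) (a : ℤ) :
    MeasurePreserving (CondC.power CondC.shift a) γ γ := by
  have := h.isProbabilityMeasure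
  refine ⟨by fun_prop, ?_⟩
  have := Measure.isProbabilityMeasure_map (μ := γ) (measurable_power_shift a).aemeasurable
  refine ext_of_integral_seqChar fun t => ?_
  rw [integral_map (by fun_prop) (by fun_prop)]
  simp_rw [seqChar_power_shift, h.integral_seqChar, norm_linearCombination_shiftFinsupp hr]

theorem IsGaussianLawOf.memLp (h : IsGaussianLawOf v γ) (t : ℤ →₀ ℝ) :
    MemLp (fun ω => Finsupp.linearCombination ℝ ω t) 2 γ := by
  have h1 := memLp_id_gaussianReal (μ := 0) (v := ‖Finsupp.linearCombination ℝ v t‖₊ ^ 2) 2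
  rw [← h.map_linearCombination, memLp_map_measure_iff (by fun_prop) (by fun_prop)] at h1
  exact h1

theorem IsGaussianLawOf.integral_sq (h : IsGaussianLawOf v γ) (t : ℤ →₀ ℝ) :
    ∫ ω, (Finsupp.linearCombination ℝ ω t) ^ 2 ∂γ = ‖Finsupp.linearCombination ℝ v t‖ ^ 2 := by
  have h1 := variance_fun_id_gaussianReal (μ := 0) (v := ‖Finsupp.linearCombination ℝ v t‖₊ ^ 2)
  rw [variance_of_integral_eq_zero (by fun_prop) integral_id_gaussianReal,
    ← h.map_linearCombination, integral_map (by fun_prop) (by fun_prop)] at h1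
  simpa using h1

/-- Polarisation: the structure only records laws of single linear combinations, that is, second
moments of `ω n ± ω m`. -/
theorem IsGaussianLawOf.integral_mul (h : IsGaussianLawOf v γ) (n m : ℤ) :
    ∫ ω, ω n * ω m ∂γ = inner ℝ (v n) (v m) := by
  have hp := h.integral_sq (Finsupp.single n 1 + Finsupp.single m 1)
  have hm := h.integral_sq (Finsupp.single n 1 - Finsupp.single m 1)
  have hpi := (h.memLp (Finsupp.single n 1 + Finsupp.single m 1)).integrable_sq
  have hmi := (h.memLp (Finsupp.single n 1 - Finsupp.single m 1)).integrable_sq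
  simp only [map_add, map_sub, Finsupp.linearCombination_single, one_smul] at hp hm hpi hmi
  have h1 : ∀ ω : ℤ → ℝ, ω n * ω m = ((ω n + ω m) ^ 2 - (ω n - ω m) ^ 2) / 4 := fun ω => by ring
  simp_rw [h1]
  rw [integral_div, integral_sub hpi hmi, hp, hm, norm_add_sq_real, norm_sub_sq_real]
  ring

theorem IsGaussianLawOf.coe_mem_gaussian (h : IsGaussianLawOf v γ) {f : Lp ℝ 2 γ}
    (hf : f ∈ CondC.firstChaos γ) : ∃ w : ℝ≥0, γ.map f = gaussianReal 0 w := by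
  have := h.isProbabilityMeasure
  have hspan : ∀ g ∈ Submodule.span ℝ {f : Lp ℝ 2 γ | ∃ n : ℤ, f =ᵐ[γ] fun ω => ω n},
      ∃ t : ℤ →₀ ℝ, g =ᵐ[γ] fun ω => Finsupp.linearCombination ℝ ω t := by
    intro g hg
    induction hg using Submodule.span_induction with
    | mem x hx =>
      obtain ⟨n, hn⟩ := hx
      exact ⟨Finsupp.single n 1, by simpa using hn⟩
    | zero => exact ⟨0, by simp only [map_zero]; exact Lp.coeFn_zero ℝ 2 γ⟩
    | add x y _ _ hx hy =>
      obtain ⟨s, hs⟩ := hx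
      obtain ⟨t, ht⟩ := hy
      refine ⟨s + t, ?_⟩
      filter_upwards [hs, ht, Lp.coeFn_add x y] with ω h1 h2 h3
      rw [h3, Pi.add_apply, h1, h2, map_add]
    | smul a x _ hx =>
      obtain ⟨s, hs⟩ := hx
      refine ⟨a • s, ?_⟩
      filter_upwards [hs, Lp.coeFn_smul a x] with ω h1 h3
      rw [h3, Pi.smul_apply, h1, map_smul]
  refine ⟨‖f‖₊ ^ 2, closure_minimal (fun g hg => ?_) (isClosed_setOf_map_eq_gaussianReal (P := γ)) hf⟩
  obtain ⟨t, ht⟩ := hspan g hg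
  have h1 : ‖g‖ ^ 2 = ‖Finsupp.linearCombination ℝ v t‖ ^ 2 := by
    rw [← h.integral_sq, ← real_inner_self_eq_norm_sq, L2.inner_def]
    refine integral_congr_ae ?_
    filter_upwards [ht] with ω h2
    rw [h2, real_inner_self_eq_norm_sq, Real.norm_eq_abs, sq_abs]
  have h2 : ‖g‖₊ ^ 2 = ‖Finsupp.linearCombination ℝ v t‖₊ ^ 2 := NNReal.eq h1
  change γ.map g = _
  rw [h2, Measure.map_congr ht, h.map_linearCombination]

theorem IsGaussianLawOf.isGaussianMeasure (h : IsGaussianLawOf v γ) {ρ : Measure UnitAddCircle}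
    (hρ : ∀ m n, ((inner ℝ (v n) (v m) : ℝ) : ℂ) = ∫ x, fourier (m - n) x ∂ρ) :
    CondC.IsGaussianMeasure ρ γ where
  isProbabilityMeasure := h.isProbabilityMeasure
  memLp n := by simpa using h.memLp (Finsupp.single n 1)
  gaussian _ hf := h.coe_mem_gaussian hf
  correlation m n := by rw [h.integral_mul, hρ]

/-- A nondegenerate linear combination of the coordinates of a Gaussian process has no atoms. -/
theorem IsGaussianLawOf.measure_linearCombination_eq (h : IsGaussianLawOf v γ) (t : ℤ →₀ ℝ)
    (ht : Finsupp.linearCombination ℝ v t ≠ 0) (c : ℝ) :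
    γ {ω | Finsupp.linearCombination ℝ ω t = c} = 0 := by
  have h1 := nullSingletonClass_gaussianReal (μ := 0)
    (v := ‖Finsupp.linearCombination ℝ v t‖₊ ^ 2) (by simpa using ht)
  have h2 := measure_singleton (μ := gaussianReal 0 (‖Finsupp.linearCombination ℝ v t‖₊ ^ 2)) c
  rw [← h.map_linearCombination, Measure.map_apply (by fun_prop) (measurableSet_singleton c)] at h2
  exact h2

/-- A point of period `n` satisfies `ω n = ω 0`, and the Gaussian variable `ω n - ω 0` has positive
variance, hence no atom at `0`. -/
theorem IsGaussianLawOf.aperiodic_shift (h : IsGaussianLawOf v γ)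
    (hv : ∀ n : ℕ, 1 ≤ n → v n ≠ v 0) : CondC.Aperiodic γ CondC.shift := by
  have h1 (n : ℕ) (hn : 1 ≤ n) : γ {ω | CondC.power CondC.shift (n : ℤ) ω = ω} = 0 := by
    refine measure_mono_null (fun ω hω => ?_) (h.measure_linearCombination_eq
      (Finsupp.single (n : ℤ) 1 - Finsupp.single 0 1) ?_ 0)
    · have h2 := congrFun (show CondC.power CondC.shift (n : ℤ) ω = ω from hω) 0
      rw [power_shift_apply, zero_add] at h2
      simp [h2]
    · simpa [sub_eq_zero] using hv n hn
  have h2 : {ω | ∃ n : ℕ, 1 ≤ n ∧ CondC.power CondC.shift (n : ℤ) ω = ω}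
      = ⋃ n : ℕ, ⋃ _ : 1 ≤ n, {ω | CondC.power CondC.shift (n : ℤ) ω = ω} := by
    ext ω
    simp
  rw [CondC.Aperiodic, h2, measure_iUnion_null_iff]
  exact fun n => measure_iUnion_null fun hn => h1 n hn

theorem IsGaussianLawOf.noAtoms (h : IsGaussianLawOf v γ) (hv : v 0 ≠ 0) (ω : ℤ → ℝ) :
    γ {ω} = 0 := by
  refine measure_mono_null ?_ (h.measure_linearCombination_eq (Finsupp.single 0 1)
    (by simpa using hv) (ω 0))
  rintro _ rfl
  simp

theorem inner_toLp_seqChar [IsFiniteMeasure γ] (s t : ℤ →₀ ℝ) :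
    inner ℂ ((memLp_seqChar γ t).toLp) ((memLp_seqChar γ s).toLp) = ∫ ω, seqChar (s - t) ω ∂γ := by
  rw [L2.inner_def]
  refine integral_congr_ae ?_
  filter_upwards [(memLp_seqChar γ t).coeFn_toLp, (memLp_seqChar γ s).coeFn_toLp] with ω h1 h2
  rw [h1, h2, RCLike.inner_apply, mul_comm, conj_seqChar_mul]

theorem abs_exp_sub_exp_le {x y : ℝ} (hx : x ≤ 0) (hy : y ≤ 0) :
    |Real.exp x - Real.exp y| ≤ |x - y| := by
  wlog hxy : x ≤ y generalizing x y
  · rw [abs_sub_comm, abs_sub_comm x]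
    exact this hy hx (le_of_not_ge hxy)
  rw [abs_sub_comm, abs_sub_comm x, abs_of_nonneg (sub_nonneg.2 hxy),
    abs_of_nonneg (sub_nonneg.2 (Real.exp_le_exp.2 hxy))]
  have h1 : Real.exp x = Real.exp y * Real.exp (x - y) := by rw [← Real.exp_add]; ring_nf
  have h2 := Real.add_one_le_exp (x - y)
  have h3 := Real.exp_le_one_iff.2 hy
  have h4 := Real.exp_pos y
  nlinarith

/-- A Gaussian system inherits from its covariances rigidity (`ξ = 0`) or mixing (`ξ = 1`), on
average. -/
theorem IsGaussianLawOf.nullOnAverage (h : IsGaussianLawOf v γ)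
    (hr : ∀ i j, inner ℝ (v i) (v j) = r (j - i)) {ξ : ℝ} (hξ : ξ = 0 ∨ ξ = 1)
    {F : ℕ → Finset ℕ} {a : ℕ → ℤ}
    (hF : ∀ m, NullOnAverage F fun n => r (m + a n) - (1 - ξ) * r m) {A B : Set (ℤ → ℝ)}
    (hA : MeasurableSet A) (hB : MeasurableSet B) :
    NullOnAverage F fun n => γ.real (A ∩ CondC.power CondC.shift (a n) ⁻¹' B)
      - ((1 - ξ) * γ.real (A ∩ B) + ξ * (γ.real A * γ.real B)) := by
  have := h.isProbabilityMeasure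
  have hT := h.measurePreserving_power hr
  let K (n : ℕ) : Lp ℂ 2 γ →L[ℂ] Lp ℂ 2 γ :=
    (Lp.compMeasurePreservingₗᵢ ℂ _ (hT (a n))).toContinuousLinearMap
  let one : Lp ℂ 2 γ := (memLp_seqChar γ 0).toLp
  -- The expected weak limit of the Koopman operators `K n`: the identity for `ξ = 0`, the
  -- projection onto the constants for `ξ = 1`.
  let R : Lp ℂ 2 γ →L[ℂ] Lp ℂ 2 γ := ((1 - ξ : ℝ) : ℂ) • ContinuousLinearMap.id ℂ _
    + (ξ : ℂ) • (innerSL ℂ one).smulRight one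
  have hK (n : ℕ) : ‖K n - R‖ ≤ 1 + ‖R‖ :=
    (norm_sub_le _ _).trans (add_le_add_left (LinearIsometry.norm_toContinuousLinearMap_le _) _)
  have hin (n : ℕ) (f g : Lp ℂ 2 γ) : inner ℂ f ((K n - R) g) = inner ℂ f (K n g)
      - (((1 - ξ : ℝ) : ℂ) * inner ℂ f g + (ξ : ℂ) * (inner ℂ f one * inner ℂ one g)) := by
    simp only [R, sub_apply, add_apply, inner_sub_right,
      inner_add_right, smul_apply, inner_smul_right,
      ContinuousLinearMap.smulRight_apply, innerSL_apply_apply, ContinuousLinearMap.id_apply]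
    ring
  have hchar : ∀ f ∈ Set.range (fun t => (memLp_seqChar γ t).toLp),
      ∀ g ∈ Set.range (fun t => (memLp_seqChar γ t).toLp),
        NullOnAverage F fun n => inner ℂ f ((K n - R) g) := by
    rintro _ ⟨t, rfl⟩ _ ⟨s, rfl⟩
    have hKs (n : ℕ) : K n ((memLp_seqChar γ s).toLp)
        = (memLp_seqChar γ (shiftFinsupp (a n) s)).toLp := by
      change Lp.compMeasurePreserving _ (hT (a n)) _ = _
      rw [Lp.toLp_compMeasurePreserving]
      exact MemLp.toLp_congr _ _ (ae_of_all _ fun ω => seqChar_power_shift _ _ _)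
    set x := Finsupp.linearCombination ℝ v t with hx
    set y := Finsupp.linearCombination ℝ v s with hy
    let c (n : ℕ) : ℝ := inner ℝ x (Finsupp.linearCombination ℝ v (shiftFinsupp (a n) s))
    have hc : NullOnAverage F fun n => c n - (1 - ξ) * inner ℝ x y := by
      have h1 (n : ℕ) : c n - (1 - ξ) * inner ℝ x y = ∑ i ∈ t.support, ∑ j ∈ s.support,
          t i * s j * (r (j - i + a n) - (1 - ξ) * r (j - i)) := by
        simp only [c]
        rw [hx, hy, inner_linearCombination_shiftFinsupp hr, inner_linearCombination hr]
        simp_rw [Finset.mul_sum, ← Finset.sum_sub_distrib]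
        refine Finset.sum_congr rfl fun i _ => Finset.sum_congr rfl fun j _ => ?_
        ring
      simp_rw [h1]
      exact NullOnAverage.sum fun i _ => NullOnAverage.sum fun j _ =>
        (hF (j - i)).of_le_mul |t i * s j| fun n => by simp [abs_mul]
    refine hc.mono fun n => ?_
    rw [hin, hKs]
    simp only [one, inner_toLp_seqChar, h.integral_seqChar, map_sub, sub_zero, zero_sub,
      map_neg, norm_neg, ← hx, ← hy]
    rw [norm_sub_sq_real, norm_sub_sq_real, norm_linearCombination_shiftFinsupp hr, ← hy,
      real_inner_comm, real_inner_comm x y]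
    -- For `ξ ∈ {0, 1}` the limiting correlation is a single exponential, obtained from that of `K
    -- n` by replacing the covariance `c n` with `(1 - ξ) ⟨x, y⟩`. As `exp` is 1-Lipschitz on
    -- nonpositive numbers, the difference is bounded by that of the covariances.
    have h2 : ((1 - ξ : ℝ) : ℂ) * Complex.exp (-((‖y‖ ^ 2 - 2 * inner ℝ x y + ‖x‖ ^ 2) / 2 : ℝ))
        + (ξ : ℂ) * (Complex.exp (-(‖x‖ ^ 2 / 2 : ℝ)) * Complex.exp (-(‖y‖ ^ 2 / 2 : ℝ)))
        = Real.exp (-(‖y‖ ^ 2 - 2 * ((1 - ξ) * inner ℝ x y) + ‖x‖ ^ 2) / 2) := by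
      rcases hξ with rfl | rfl
      · simp only [sub_zero, Complex.ofReal_one, one_mul, Complex.ofReal_zero, zero_mul, add_zero,
          Complex.ofReal_exp, ← Complex.ofReal_neg]
        congr 2
        ring
      · rw [← Complex.exp_add]
        push_cast
        simp only [sub_self, zero_mul, one_mul, zero_add]
        congr 1
        ring
    rw [h2, ← Complex.ofReal_neg, ← Complex.ofReal_exp, ← Complex.ofReal_sub, Complex.norm_real]
    refine (abs_exp_sub_exp_le ?_ ?_).trans ?_
    · have := norm_linearCombination_shiftFinsupp hr (a n) s
      have h3 := real_inner_le_norm x (Finsupp.linearCombination ℝ v (shiftFinsupp (a n) s))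
      rw [this, ← hy] at h3
      nlinarith [sq_nonneg (‖x‖ - ‖y‖)]
    · have h3 := real_inner_le_norm x y
      rcases hξ with rfl | rfl
      · nlinarith [sq_nonneg (‖x‖ - ‖y‖)]
      · nlinarith [sq_nonneg (‖x‖), sq_nonneg ‖y‖]
    · rw [Real.norm_eq_abs]
      refine le_of_eq ?_
      congr 1
      simp only [c]
      ring
  have hfin := nullOnAverage_inner_of_dense (F := F) (fun n => K n - R) hK
    (span_seqChar_dense γ) hchar
    (indicatorConstLp 2 hA (measure_ne_top γ A) 1) (indicatorConstLp 2 hB (measure_ne_top γ B) 1)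
  have hone : one = indicatorConstLp 2 MeasurableSet.univ (measure_ne_top γ _) 1 := by
    refine Lp.ext ?_
    filter_upwards [(memLp_seqChar γ 0).coeFn_toLp, indicatorConstLp_coeFn (p := 2)
      (hs := MeasurableSet.univ) (hμs := measure_ne_top γ _) (c := (1 : ℂ))] with ω h1 h2
    rw [h1, h2, seqChar_zero, Set.indicator_univ]
  have hKB (n : ℕ) : K n (indicatorConstLp 2 hB (measure_ne_top γ B) 1)
      = indicatorConstLp 2 ((measurable_power_shift (a n)) hB) (measure_ne_top γ _) 1 :=
    Lp.indicatorConstLp_compMeasurePreserving hB _ 1 (hT (a n))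
  refine hfin.mono fun n => ?_
  rw [hin, hKB, hone]
  simp only [L2.inner_indicatorConstLp_indicatorConstLp, Set.inter_univ, Set.univ_inter,
    RCLike.inner_apply, map_one, mul_one, Complex.real_smul, ← Complex.ofReal_mul,
    ← Complex.ofReal_add, ← Complex.ofReal_sub, Complex.norm_real]
  exact le_rfl

end GaussianSystem

/-! ### Limits along sequences and weak mixing from covariances -/

section Mixing

variable {E : Type*} [NormedAddCommGroup E] [InnerProductSpace ℝ E] {v : ℤ → E}
  {γ : Measure (ℤ → ℝ)} {r : ℤ → ℝ}

theorem IsGaussianLawOf.limitAlong (h : IsGaussianLawOf v γ)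
    (hr : ∀ i j, inner ℝ (v i) (v j) = r (j - i)) {ξ : ℝ} (hξ : ξ = 0 ∨ ξ = 1) {a : ℕ → ℤ}
    (ha : ∀ m, Tendsto (fun k => r (m + a k)) atTop (𝓝 ((1 - ξ) * r m))) :
    CondC.LimitAlong γ CondC.shift a ξ := by
  intro A B hA hB
  have h1 := h.nullOnAverage hr hξ (F := fun k => {k}) (a := a)
    (fun m => nullOnAverage_singleton.2 (by simpa using (ha m).sub_const ((1 - ξ) * r m))) hA hB
  rw [nullOnAverage_singleton] at h1
  simpa using h1.add_const ((1 - ξ) * γ.real (A ∩ B) + ξ * (γ.real A * γ.real B))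

theorem IsGaussianLawOf.weaklyMixing (h : IsGaussianLawOf v γ)
    (hr : ∀ i j, inner ℝ (v i) (v j) = r (j - i))
    (hm : ∀ m : ℤ, NullOnAverage (fun M => Finset.Icc 1 M) fun n => r (m + n)) :
    CondC.WeaklyMixing γ CondC.shift := by
  refine ⟨h.measurePreserving_power hr 1, fun A B hA hB => ?_⟩
  have h1 := h.nullOnAverage hr (Or.inr rfl) (F := fun M => Finset.Icc 1 M) (a := fun n => n)
    (fun m => by simpa using hm m) hA hB
  simpa [NullOnAverage] using h1

end Mixing

/-! ### Wiener's lemma -/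

section Wiener

theorem norm_fourier_eq_one (n : ℤ) (x : UnitAddCircle) : ‖(fourier n x : ℂ)‖ = 1 := by
  rw [fourier_apply, Circle.norm_coe]

theorem fourier_mul_fourier_neg (m : ℤ) (n : ℕ) (x y : UnitAddCircle) :
    (fourier (m + n) x * fourier (-(m + n)) y : ℂ)
      = fourier m x * fourier (-m) y * (fourier 1 x * fourier (-1) y : ℂ) ^ n := by
  induction n with
  | zero => simp
  | succ n ih =>
    rw [pow_succ, ← mul_assoc, ← ih]
    have h1 : -(m + ((n + 1 : ℕ) : ℤ)) = -(m + n) + -1 := by push_cast; ring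
    have h2 : m + ((n + 1 : ℕ) : ℤ) = (m + n) + 1 := by push_cast; ring
    rw [h1, h2, fourier_add (m := m + n) (n := 1), fourier_add (m := -(m + n)) (n := -1)]
    ring

theorem fourier_one_mul_fourier_neg_one_eq_one {x y : UnitAddCircle}
    (h : (fourier 1 x * fourier (-1) y : ℂ) = 1) : x = y := by
  rw [fourier_neg, ← Complex.inv_eq_conj (norm_fourier_eq_one 1 y), mul_inv_eq_one₀
    (fun h0 => by have := norm_fourier_eq_one 1 y; simp [h0] at this), fourier_apply, fourier_apply,
    one_zsmul, one_zsmul] at h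
  exact AddCircle.injective_toCircle one_ne_zero (Circle.ext h)

theorem norm_sum_pow_mul_norm_sub_one_le {z : ℂ} (hz : ‖z‖ = 1) (M : ℕ) :
    ‖∑ n ∈ Finset.Icc 1 M, z ^ n‖ * ‖z - 1‖ ≤ 2 := by
  have h1 : (∑ n ∈ Finset.Icc 1 M, z ^ n) * (z - 1) = z ^ (M + 1) - z := by
    induction M with
    | zero => simp
    | succ M ih =>
      rw [Finset.sum_Icc_succ_top (by omega), add_mul, ih]
      ring
  rw [← norm_mul, h1]
  refine (norm_sub_le _ _).trans ?_
  rw [norm_pow, hz, one_pow]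
  norm_num

theorem integrable_fourier (σ : Measure UnitAddCircle) [IsFiniteMeasure σ] (n : ℤ) :
    Integrable (fun x => (fourier n x : ℂ)) σ :=
  Integrable.of_bound (C := 1) (by fun_prop) (ae_of_all _ fun x => (norm_fourier_eq_one n x).le)

/-- Wiener's lemma: the Fourier coefficients of a measure without atoms tend to zero on average. -/
theorem nullOnAverage_integral_fourier (σ : Measure UnitAddCircle) [IsFiniteMeasure σ]
    (hσ : ∀ x, σ {x} = 0) (m : ℤ) :
    NullOnAverage (fun M => Finset.Icc 1 M) fun n => ∫ x, (fourier (m + n) x : ℂ) ∂σ := by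
  set c : ℕ → ℂ := fun n => ∫ x, (fourier (m + n) x : ℂ) ∂σ with hc
  -- The squared coefficient is a double integral of powers of `z = e(x - y)`, up to a factor of
  -- modulus one. Off the diagonal, which is null as `σ` has no atoms, the geometric sums stay
  -- bounded and the averages tend to `0`.
  have hsq (n : ℕ) : ((‖c n‖ ^ 2 : ℝ) : ℂ) = ∫ p : UnitAddCircle × UnitAddCircle,
      (fourier (m + n) p.1 * fourier (-(m + n)) p.2 : ℂ) ∂(σ.prod σ) := by
    rw [integral_prod_mul, Complex.ofReal_pow, ← Complex.mul_conj']
    congr 1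
    rw [hc, ← integral_conj]
    simp_rw [fourier_neg]
  have hint (n : ℕ) : Integrable (fun p : UnitAddCircle × UnitAddCircle =>
      (fourier (m + n) p.1 * fourier (-(m + n)) p.2 : ℂ)) (σ.prod σ) :=
    (integrable_fourier σ _).mul_prod (integrable_fourier σ _)
  have hdiag : ∀ᵐ p : UnitAddCircle × UnitAddCircle ∂(σ.prod σ), p.1 ≠ p.2 := by
    rw [Measure.ae_prod_iff_ae_ae]
    · refine ae_of_all _ fun x => ?_
      rw [ae_iff]
      simpa using hσ x
    · exact (measurableSet_eq_fun measurable_fst measurable_snd).compl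
  have hlim : Tendsto (fun M : ℕ => ∫ p : UnitAddCircle × UnitAddCircle,
      ((M : ℂ)⁻¹ * ∑ n ∈ Finset.Icc 1 M, (fourier (m + n) p.1 * fourier (-(m + n)) p.2 : ℂ))
        ∂(σ.prod σ)) atTop (𝓝 (∫ _, 0 ∂(σ.prod σ))) := by
    refine tendsto_integral_of_dominated_convergence (fun _ => 1) (fun M => ?_)
      (integrable_const _) (fun M => ae_of_all _ fun p => ?_) ?_
    · exact ((integrable_finsetSum _ fun n _ => hint n).const_mul _).aestronglyMeasurable
    · rw [norm_mul, norm_inv, Complex.norm_natCast]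
      have : ‖∑ n ∈ Finset.Icc 1 M, (fourier (m + n) p.1 * fourier (-(m + n)) p.2 : ℂ)‖ ≤ M := by
        refine (norm_sum_le _ _).trans ?_
        simp only [norm_mul, norm_fourier_eq_one]
        simp
      calc (M : ℝ)⁻¹ * _ ≤ (M : ℝ)⁻¹ * M := by gcongr
        _ ≤ 1 := inv_mul_le_one
    · filter_upwards [hdiag] with p hp
      set z : ℂ := fourier 1 p.1 * fourier (-1) p.2 with hz
      have hz1 : z - 1 ≠ 0 := fun h => hp (fourier_one_mul_fourier_neg_one_eq_one (sub_eq_zero.1 h))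
      have hzn : ‖z‖ = 1 := by rw [hz, norm_mul, norm_fourier_eq_one, norm_fourier_eq_one, one_mul]
      have h1 : Tendsto (fun M : ℕ => (M : ℝ)⁻¹ * (2 / ‖z - 1‖)) atTop (𝓝 0) := by
        simpa using tendsto_inv_atTop_nhds_zero_nat.mul_const (2 / ‖z - 1‖)
      refine squeeze_zero_norm (fun M => ?_) h1
      rw [norm_mul, norm_inv, Complex.norm_natCast]
      gcongr
      simp_rw [fourier_mul_fourier_neg, ← Finset.mul_sum, norm_mul, norm_fourier_eq_one, one_mul]
      rw [le_div_iff₀ (norm_pos_iff.2 hz1)]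
      exact norm_sum_pow_mul_norm_sub_one_le hzn M
  have hlim2 : Tendsto (fun M : ℕ => (M : ℝ)⁻¹ * ∑ n ∈ Finset.Icc 1 M, ‖c n‖ ^ 2) atTop (𝓝 0) := by
    rw [← tendsto_ofReal_iff]
    convert hlim using 2 with M
    · rw [integral_const_mul, integral_finsetSum _ fun n _ => hint n]
      simp_rw [← hsq]
      push_cast
      rfl
    · simp
  -- Cauchy–Schwarz passes from averages of squares to averages of absolute values.
  have hsqrt := hlim2.sqrt
  rw [Real.sqrt_zero] at hsqrt
  refine squeeze_zero (fun M => by positivity) (fun M => ?_) hsqrt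
  refine Real.le_sqrt_of_sq_le ?_
  rw [Nat.card_Icc, Nat.add_sub_cancel, mul_pow]
  have := sq_sum_le_card_mul_sum_sq (s := Finset.Icc 1 M) (f := fun n => ‖c n‖)
  rw [Nat.card_Icc, Nat.add_sub_cancel] at this
  rcases Nat.eq_zero_or_pos M with rfl | hM
  · simp
  calc (M : ℝ)⁻¹ ^ 2 * (∑ n ∈ Finset.Icc 1 M, ‖c n‖) ^ 2
      ≤ (M : ℝ)⁻¹ ^ 2 * (M * ∑ n ∈ Finset.Icc 1 M, ‖c n‖ ^ 2) := by gcongr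
    _ = _ := by field_simp

end Wiener

/-! ### The Gaussian system of an atomless spectral measure -/

section SpectralMeasure

variable (σ : Measure UnitAddCircle) [IsFiniteMeasure σ]

theorem memLp_fourier (n : ℤ) : MemLp (fun x => (fourier n x : ℂ)) 2 σ :=
  MemLp.of_bound (by fun_prop) 1 (ae_of_all _ fun x => (norm_fourier_eq_one n x).le)

/-- The characters of the circle as vectors of `L²(σ)`. -/
noncomputable def fourierVec (n : ℤ) : Lp ℂ 2 σ := (memLp_fourier σ n).toLp

theorem inner_fourierVec (i j : ℤ) :
    inner ℝ (fourierVec σ i) (fourierVec σ j) = (∫ x, (fourier (j - i) x : ℂ) ∂σ).re := by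
  rw [L2.inner_def, ← RCLike.re_to_complex, ← integral_re (integrable_fourier σ _)]
  refine integral_congr_ae ?_
  filter_upwards [(memLp_fourier σ i).coeFn_toLp, (memLp_fourier σ j).coeFn_toLp] with x h1 h2
  rw [fourierVec, fourierVec, h1, h2, sub_eq_add_neg, fourier_add, fourier_neg,
    RCLike.re_to_complex]
  simp [Complex.inner, mul_comm]

omit [IsFiniteMeasure σ] in
theorem integral_fourier_neg (n : ℤ) :
    ∫ x, (fourier (-n) x : ℂ) ∂σ = starRingEnd ℂ (∫ x, (fourier n x : ℂ) ∂σ) := by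
  rw [← integral_conj]
  simp_rw [fourier_neg]

/-- The symmetrisation of a measure on the circle. -/
noncomputable def symmetrization : Measure UnitAddCircle :=
  (2⁻¹ : ℝ≥0) • (σ + σ.map Neg.neg)

/-- The measure `σ` need not be symmetric, but the real inner products of the `fourierVec σ n` see
only the real parts of its coefficients, and those belong to the symmetrisation. -/
theorem integral_fourier_symmetrization (n : ℤ) :
    ∫ x, (fourier n x : ℂ) ∂(symmetrization σ) = ((∫ x, (fourier n x : ℂ) ∂σ).re : ℂ) := by
  rw [symmetrization, integral_smul_nnreal_measure, integral_add_measure (integrable_fourier σ n)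
    (integrable_fourier _ n), integral_map (by fun_prop) (by fun_prop)]
  have : ∀ x : UnitAddCircle, (fourier n (-x) : ℂ) = fourier (-n) x := fun x => by
    simp [fourier_apply]
  simp_rw [this]
  rw [integral_fourier_neg, Complex.add_conj, NNReal.smul_def, Complex.real_smul]
  push_cast
  ring

variable {σ}

/-- Equality would concentrate `σ` on the finite set of `n`-torsion points, which is null because
`σ` has no atoms. -/
theorem fourierVec_ne (hσ : ∀ x, σ {x} = 0) (h0 : σ ≠ 0) (n : ℕ) (hn : 1 ≤ n) :
    fourierVec σ n ≠ fourierVec σ 0 := by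
  intro h
  have h1 : ∀ᵐ x ∂σ, x ∈ {u : UnitAddCircle | n • u = 0} := by
    filter_upwards [(memLp_fourier σ n).coeFn_toLp, (memLp_fourier σ 0).coeFn_toLp] with x h1 h2
    have h3 : (fourier (n : ℤ) x : ℂ) = fourier 0 x := by
      rw [← h1, ← h2]
      exact congrArg (fun f : Lp ℂ 2 σ => f x) h
    rw [fourier_apply, fourier_apply] at h3
    have h4 := AddCircle.injective_toCircle (T := (1 : ℝ)) one_ne_zero (Circle.ext h3)
    simpa using h4
  have h2 : σ {u : UnitAddCircle | n • u = 0} = 0 := by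
    have : NullSingletonClass σ := ⟨hσ⟩
    exact (AddCircle.finite_torsion 1 hn).measure_zero σ
  refine h0 (Measure.measure_univ_eq_zero.1 ?_)
  rw [← Set.union_compl_self {u : UnitAddCircle | n • u = 0}]
  exact measure_union_null h2 h1

theorem fourierVec_zero_ne (h0 : σ ≠ 0) : fourierVec σ 0 ≠ 0 := by
  intro h
  have h1 := inner_fourierVec σ 0 0
  rw [h, inner_zero_left] at h1
  simp only [sub_self, fourier_zero, integral_const] at h1
  have : σ.real Set.univ = 0 := by simpa using h1.symm
  rw [measureReal_eq_zero_iff] at this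
  exact h0 (Measure.measure_univ_eq_zero.1 this)

variable (σ) in
/-- The Gaussian system of a spectral measure without atoms. -/
theorem exists_gaussian_system (hσ : ∀ x, σ {x} = 0) (h0 : σ ≠ 0) :
    ∃ γ : Measure (ℤ → ℝ), IsProbabilityMeasure γ ∧ CondC.IsNontrivialGaussianSystem γ ∧
      CondC.WeaklyMixing γ CondC.shift ∧ CondC.Aperiodic γ CondC.shift ∧ (∀ ω, γ {ω} = 0) ∧
      ∀ (a : ℕ → ℤ) (ξ : ℝ), (ξ = 0 ∨ ξ = 1) →
        (∀ m, Tendsto (fun k => ∫ x, (fourier (m + a k) x : ℂ) ∂σ) atTop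
          (𝓝 ((1 - ξ : ℝ) * ∫ x, (fourier m x : ℂ) ∂σ))) →
        CondC.LimitAlong γ CondC.shift a ξ := by
  obtain ⟨γ, hγ⟩ := exists_isGaussianLawOf (fourierVec σ)
  have hr (i j : ℤ) : inner ℝ (fourierVec σ i) (fourierVec σ j)
      = (fun n => (∫ x, (fourier n x : ℂ) ∂σ).re) (j - i) := inner_fourierVec σ i j
  refine ⟨γ, hγ.isProbabilityMeasure, ⟨symmetrization σ, ?_, fun n => ?_, fun h => h0 ?_,
    hγ.isGaussianMeasure fun m n => ?_⟩, hγ.weaklyMixing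
      (r := fun n => (∫ x, (fourier n x : ℂ) ∂σ).re) hr fun m => ?_,
    hγ.aperiodic_shift (by exact_mod_cast fourierVec_ne hσ h0), hγ.noAtoms (fourierVec_zero_ne h0),
    fun a ξ hξ ha => hγ.limitAlong (r := fun n => (∫ x, (fourier n x : ℂ) ∂σ).re) hr hξ fun m => ?_⟩
  · unfold symmetrization
    infer_instance
  · rw [integral_fourier_symmetrization, integral_fourier_symmetrization, integral_fourier_neg,
      Complex.conj_re]
  · have h1 := integral_fourier_symmetrization σ 0
    rw [h] at h1
    simp only [fourier_zero, integral_const] at h1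
    have : σ.real Set.univ = 0 := by simpa using h1.symm
    rw [measureReal_eq_zero_iff] at this
    exact Measure.measure_univ_eq_zero.1 this
  · rw [hr, integral_fourier_symmetrization]
  · exact (nullOnAverage_integral_fourier σ hσ m).mono fun n => Complex.abs_re_le_norm _
  · have h1 := (Complex.continuous_re.tendsto _).comp (ha m)
    rw [Complex.re_ofReal_mul] at h1
    exact h1

end SpectralMeasure

/-! ### Digit expansions with rapidly growing denominators -/

section DigitExpansion

/-- The number `∑ a_i / (m M_i)`. -/
noncomputable def digitSum {m : ℕ} (M : ℕ → ℕ) (a : ℕ → Fin m) : ℝ :=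
  ∑' i, (a i : ℝ) / (m * M i)

variable {m : ℕ} {M s : ℕ → ℕ}

theorem pos_of_step (hm : 2 ≤ m) (hM0 : 0 < M 0) (hs : ∀ k, M (k + 1) = M k * s k)
    (hs0 : ∀ k, m ≤ s k) (k : ℕ) : 0 < M k := by
  induction k with
  | zero => exact hM0
  | succ k ih =>
    rw [hs]
    have := hs0 k
    exact Nat.mul_pos ih (by omega)

theorem mul_two_pow_le (hm : 2 ≤ m) (hs : ∀ k, M (k + 1) = M k * s k)
    (hs0 : ∀ k, m ≤ s k) (k i : ℕ) : M k * 2 ^ i ≤ M (i + k) := by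
  induction i with
  | zero => simp
  | succ i ih =>
    rw [show i + 1 + k = (i + k) + 1 by ring, hs, pow_succ, ← mul_assoc]
    exact Nat.mul_le_mul ih (hm.trans (hs0 _))

/-- This is why multiplication by `M k` turns all terms `a_i / (m M_i)` with `i < k` into integers.
-/
theorem mul_dvd_of_lt (hs : ∀ k, M (k + 1) = M k * s k) (hms : ∀ k, m ∣ s k) {i k : ℕ}
    (h : i < k) : m * M i ∣ M k := by
  induction k, h using Nat.le_induction with
  | base => rw [hs, mul_comm]; exact Nat.mul_dvd_mul_left _ (hms i)
  | succ k _ ih => rw [hs]; exact ih.mul_right _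

theorem digit_term_le (hm : 2 ≤ m) (hM0 : 0 < M 0) (hs : ∀ k, M (k + 1) = M k * s k)
    (hs0 : ∀ k, m ≤ s k) (a : ℕ → Fin m) (k i : ℕ) :
    (a (i + k) : ℝ) / (m * M (i + k)) ≤ 1 / M k * (1 / 2) ^ i := by
  have hMk : (0 : ℝ) < M k := by exact_mod_cast pos_of_step hm hM0 hs hs0 k
  have hMi : (0 : ℝ) < M (i + k) := by exact_mod_cast pos_of_step hm hM0 hs hs0 (i + k)
  have h1 : (M k : ℝ) * 2 ^ i ≤ M (i + k) := by exact_mod_cast mul_two_pow_le hm hs hs0 k i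
  have hm' : (0 : ℝ) < m := by exact_mod_cast (by omega : 0 < m)
  have h2 : (a (i + k) : ℝ) ≤ m := by exact_mod_cast (a (i + k)).2.le
  calc (a (i + k) : ℝ) / (m * M (i + k)) ≤ m / (m * M (i + k)) := by gcongr
    _ = 1 / M (i + k) := by field_simp
    _ ≤ 1 / (M k * 2 ^ i) := by gcongr
    _ = _ := by rw [one_div_pow, one_div_mul_one_div]

theorem summable_digit (hm : 2 ≤ m) (hM0 : 0 < M 0) (hs : ∀ k, M (k + 1) = M k * s k)
    (hs0 : ∀ k, m ≤ s k) (a : ℕ → Fin m) : Summable fun i => (a i : ℝ) / (m * M i) :=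
  Summable.of_nonneg_of_le (fun i => by positivity) (fun i => digit_term_le hm hM0 hs hs0 a 0 i)
    (summable_geometric_two.mul_left _)

theorem digitSum_sub_mem (hm : 2 ≤ m) (hM0 : 0 < M 0) (hs : ∀ k, M (k + 1) = M k * s k)
    (hs0 : ∀ k, m ≤ s k) (a : ℕ → Fin m) (k : ℕ) :
    digitSum M a - ∑ i ∈ Finset.range k, (a i : ℝ) / (m * M i) ∈ Set.Icc (0 : ℝ) (2 / M k) := by
  have hsum := summable_digit hm hM0 hs hs0 a
  rw [digitSum, ← hsum.sum_add_tsum_nat_add k, add_sub_cancel_left]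
  refine ⟨tsum_nonneg fun i => by positivity, ?_⟩
  calc ∑' i, (a (i + k) : ℝ) / (m * M (i + k)) ≤ ∑' i : ℕ, 1 / (M k : ℝ) * (1 / 2) ^ i :=
        ((summable_nat_add_iff k).2 hsum).tsum_le_tsum (digit_term_le hm hM0 hs hs0 a k)
          (summable_geometric_two.mul_left _)
    _ = 2 / M k := by rw [tsum_mul_left, tsum_geometric_two]; ring

/-- Multiplication by `M k` isolates the `k`-th digit, modulo integers and a small error. -/
theorem mul_digitSum_eq (hm : 2 ≤ m) (hM0 : 0 < M 0) (hs : ∀ k, M (k + 1) = M k * s k)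
    (hms : ∀ k, m ∣ s k) (hs0 : ∀ k, m ≤ s k) (a : ℕ → Fin m) (k : ℕ) :
    ∃ z : ℤ, ∃ δ ∈ Set.Icc (0 : ℝ) (2 / s k), M k * digitSum M a = z + (a k : ℝ) / m + δ := by
  have hMk : (0 : ℝ) < M k := by exact_mod_cast pos_of_step hm hM0 hs hs0 k
  have hm' : (0 : ℝ) < m := by exact_mod_cast (by omega : 0 < m)
  have hsk : (0 : ℝ) < s k := by
    have := hs0 k
    exact_mod_cast (by omega : 0 < s k)
  -- The tail after the `k`-th digit is at most `2 / M (k + 1)`, which becomes `2 / s k` after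
  -- multiplication by `M k`.
  obtain ⟨h1, h2⟩ := digitSum_sub_mem hm hM0 hs hs0 a (k + 1)
  set δ := digitSum M a - ∑ i ∈ Finset.range (k + 1), (a i : ℝ) / (m * M i) with hδ
  have hz : ∃ z : ℤ, (M k : ℝ) * ∑ i ∈ Finset.range k, (a i : ℝ) / (m * M i) = z := by
    refine ⟨((∑ i ∈ Finset.range k, (a i : ℕ) * (M k / (m * M i)) : ℕ) : ℤ), ?_⟩
    rw [Finset.mul_sum, Int.cast_natCast, Nat.cast_sum]
    refine Finset.sum_congr rfl fun i hi => ?_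
    have hMi : (0 : ℝ) < M i := by exact_mod_cast pos_of_step hm hM0 hs hs0 i
    rw [Nat.cast_mul, Nat.cast_div (mul_dvd_of_lt hs hms (Finset.mem_range.1 hi)) (by push_cast; positivity)]
    push_cast
    ring
  obtain ⟨z, hz⟩ := hz
  refine ⟨z, M k * δ, ⟨by positivity, ?_⟩, ?_⟩
  · calc (M k : ℝ) * δ ≤ M k * (2 / M (k + 1)) := by gcongr
      _ = 2 / s k := by rw [hs]; push_cast; field_simp
  · rw [← hz, hδ, Finset.sum_range_succ]
    field_simp
    ring

theorem measurable_digitSum (hm : 2 ≤ m) (hM0 : 0 < M 0) (hs : ∀ k, M (k + 1) = M k * s k)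
    (hs0 : ∀ k, m ≤ s k) : Measurable (digitSum (m := m) M) := by
  refine measurable_of_tendsto_metrizable
    (f := fun k a => ∑ i ∈ Finset.range k, (a i : ℝ) / (m * M i)) (fun k => ?_) ?_
  · exact Finset.measurable_fun_sum _ fun i _ =>
      ((measurable_from_top (f := fun x : Fin m => (x : ℝ))).comp (measurable_pi_apply i)).div_const _
  · rw [tendsto_pi_nhds]
    exact fun a => (summable_digit hm hM0 hs hs0 a).hasSum.tendsto_sum_nat

/-- Points whose digit sums agree modulo one have the same digits from some point on. -/
theorem digit_eq_of_coe_eq (hm : 2 ≤ m) (hM0 : 0 < M 0) (hs : ∀ k, M (k + 1) = M k * s k)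
    (hms : ∀ k, m ∣ s k) (hs0 : ∀ k, m ≤ s k) {a b : ℕ → Fin m}
    (h : (digitSum M a : UnitAddCircle) = digitSum M b) {k : ℕ} (hk : 2 * m < s k) :
    a k = b k := by
  have hm' : (0 : ℝ) < m := by exact_mod_cast (by omega : 0 < m)
  have hsk : (0 : ℝ) < s k := by exact_mod_cast (by omega : 0 < s k)
  obtain ⟨z, δ, ⟨hδ0, hδ1⟩, hz⟩ := mul_digitSum_eq hm hM0 hs hms hs0 a k
  obtain ⟨w, ε, ⟨hε0, hε1⟩, hw⟩ := mul_digitSum_eq hm hM0 hs hms hs0 b k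
  rw [← sub_eq_zero, ← AddCircle.coe_sub, AddCircle.coe_eq_zero_iff] at h
  obtain ⟨n, hn⟩ := h
  rw [zsmul_eq_mul, mul_one] at hn
  -- After clearing the denominator `m`, an integer equals `m (δ - ε)`, which is smaller than `1` in
  -- absolute value because `2 m < s k`. So it vanishes, and `m` divides a difference of two digits.
  have h1 : ((m * (M k * n - z + w) - ((a k : ℕ) - (b k : ℕ)) : ℤ) : ℝ) = m * (δ - ε) := by
    push_cast
    rw [hn]
    have h2 : (a k : ℝ) = m * ((a k : ℝ) / m) := by field_simp
    have h3 : (b k : ℝ) = m * ((b k : ℝ) / m) := by field_simp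
    rw [h2, h3]
    linear_combination (m : ℝ) * (hz - hw)
  have h2 : (2 : ℝ) * m < s k := by exact_mod_cast hk
  have h3 : m * (2 / (s k : ℝ)) < 1 := by
    rw [← mul_div_assoc, div_lt_one hsk]
    linarith
  have h4 : |((m * (M k * n - z + w) - ((a k : ℕ) - (b k : ℕ)) : ℤ) : ℝ)| < 1 := by
    rw [h1, abs_lt]
    constructor <;> nlinarith
  have h5 : m * (M k * n - z + w) - (((a k : ℕ) : ℤ) - (b k : ℕ)) = 0 := by
    rw [← Int.abs_lt_one_iff]
    exact_mod_cast h4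
  have h6 : (m : ℤ) ∣ ((a k : ℕ) : ℤ) - (b k : ℕ) := ⟨_, (sub_eq_zero.1 h5).symm⟩
  have h7 : ((a k : ℕ) : ℤ) - (b k : ℕ) = 0 := by
    refine Int.eq_zero_of_abs_lt_dvd h6 ?_
    have := (a k).2
    have := (b k).2
    rw [abs_lt]
    omega
  exact Fin.ext (by omega)

theorem fourier_coe_eq (n : ℤ) (x : ℝ) :
    (fourier n (x : UnitAddCircle) : ℂ) = Complex.exp ((2 * Real.pi * (n * x) : ℝ) * Complex.I) := by
  rw [fourier_coe_apply]
  congr 1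
  push_cast
  ring

theorem norm_fourier_coe_sub_le (n l : ℤ) (x y : ℝ) :
    ‖(fourier n (x : UnitAddCircle) - fourier l (y : UnitAddCircle) : ℂ)‖
      ≤ 2 * Real.pi * |n * x - l * y| := by
  rw [fourier_coe_eq, fourier_coe_eq]
  refine (norm_cexp_mul_I_sub_le _ _).trans_eq ?_
  rw [← mul_sub, abs_mul, abs_of_pos (by positivity)]

/-- Modulo one, `Q M_k x` is `Q (a_k / m + δ)` with `0 ≤ δ ≤ 2 / s k`, and dropping `δ` costs at
most `2π Q δ`. -/
theorem norm_fourier_digitSum_sub_le (hm : 2 ≤ m) (hM0 : 0 < M 0)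
    (hs : ∀ k, M (k + 1) = M k * s k) (hms : ∀ k, m ∣ s k) (hs0 : ∀ k, m ≤ s k) (a : ℕ → Fin m)
    (l : ℤ) (Q k : ℕ) :
    ‖(fourier (l + (Q * M k : ℕ)) (digitSum M a : UnitAddCircle)
      - fourier l (digitSum M a : UnitAddCircle)
        * fourier Q (((a k : ℝ) / m : ℝ) : UnitAddCircle) : ℂ)‖
      ≤ 2 * Real.pi * (Q * (2 / s k)) := by
  obtain ⟨z, δ, ⟨hδ0, hδ1⟩, hz⟩ := mul_digitSum_eq hm hM0 hs hms hs0 a k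
  have h1 : (fourier (Q * M k : ℕ) (digitSum M a : UnitAddCircle) : ℂ)
      = fourier Q (((a k : ℝ) / m + δ : ℝ) : UnitAddCircle) := by
    have h2 : ((Q * M k : ℕ) : ℤ) • (digitSum M a : UnitAddCircle)
        = (Q : ℤ) • (((a k : ℝ) / m + δ : ℝ) : UnitAddCircle) := by
      rw [← AddCircle.coe_zsmul, ← AddCircle.coe_zsmul, ← sub_eq_zero, ← AddCircle.coe_sub,
        AddCircle.coe_eq_zero_iff]
      refine ⟨Q * z, ?_⟩
      simp only [zsmul_eq_mul]
      push_cast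
      linear_combination -(Q : ℝ) * hz
    rw [fourier_apply, fourier_apply, h2]
  rw [fourier_add, h1, ← mul_sub, norm_mul, norm_fourier_eq_one, one_mul]
  refine (norm_fourier_coe_sub_le _ _ _ _).trans ?_
  gcongr
  rw [← mul_sub, add_sub_cancel_left, abs_mul, abs_of_nonneg hδ0]
  simp only [Int.cast_natCast, Nat.abs_cast]
  gcongr

end DigitExpansion

/-! ### The law of a random digit expansion and its Fourier coefficients -/

section DigitMeasure

variable (m : ℕ) [NeZero m]

/-- Independent uniform digits. -/
noncomputable def digitMeasure : Measure (ℕ → Fin m) :=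
  Measure.infinitePi fun _ => (PMF.uniformOfFintype (Fin m)).toMeasure

instance : IsProbabilityMeasure (digitMeasure m) := by
  unfold digitMeasure
  infer_instance

variable {m} {M s : ℕ → ℕ}

/-- Prescribing `n` digits has probability `m⁻ⁿ ≤ 2⁻ⁿ`, for every `n`. -/
theorem digitMeasure_tail_eq_zero (hm : 2 ≤ m) (K : ℕ) (b : ℕ → Fin m) :
    digitMeasure m {a | ∀ k, K ≤ k → a k = b k} = 0 := by
  have h1 (n : ℕ) : digitMeasure m {a | ∀ k, K ≤ k → a k = b k} ≤ (2⁻¹ : ENNReal) ^ n := by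
    calc digitMeasure m {a | ∀ k, K ≤ k → a k = b k}
        ≤ digitMeasure m (Set.pi (Finset.Ico K (K + n)) fun k => {b k}) :=
          measure_mono fun a ha k hk => ha k (Finset.mem_Ico.1 hk).1
      _ = ∏ k ∈ Finset.Ico K (K + n), (PMF.uniformOfFintype (Fin m)).toMeasure {b k} :=
          Measure.infinitePi_pi _ fun _ _ => measurableSet_singleton _
      _ = ((m : ENNReal)⁻¹) ^ n := by
          simp [PMF.uniformOfFintype_apply]
      _ ≤ (2⁻¹ : ENNReal) ^ n := by
          gcongr
          exact_mod_cast hm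
  refine le_antisymm (ge_of_tendsto' (ENNReal.tendsto_pow_atTop_nhds_zero_of_lt_one ?_) h1) bot_le
  simp

theorem sum_fourier_div_eq_zero {Q : ℕ} (hQ : ¬ m ∣ Q) :
    ∑ d : Fin m, (fourier Q (((d : ℝ) / m : ℝ) : UnitAddCircle) : ℂ) = 0 := by
  have hm0 : (m : ℂ) ≠ 0 := by exact_mod_cast NeZero.ne m
  have hprim := Complex.isPrimitiveRoot_exp m (NeZero.ne m)
  set ζ := Complex.exp (2 * Real.pi * Complex.I / m) with hζ
  have h1 (d : ℕ) : (fourier Q (((d : ℝ) / m : ℝ) : UnitAddCircle) : ℂ) = (ζ ^ Q) ^ d := by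
    rw [fourier_coe_apply, ← pow_mul, hζ, ← Complex.exp_nat_mul]
    congr 1
    push_cast
    ring
  simp_rw [h1]
  rw [Fin.sum_univ_eq_sum_range fun d => (ζ ^ Q) ^ d]
  have h2 : ζ ^ Q ≠ 1 := fun h => hQ ((hprim.pow_eq_one_iff_dvd Q).1 h)
  have h3 := geom_sum_mul (ζ ^ Q) m
  rw [← pow_mul, mul_comm Q, pow_mul, hprim.pow_eq_one, one_pow, sub_self] at h3
  exact (mul_eq_zero.1 h3).resolve_right (sub_ne_zero.2 h2)

theorem integral_digit (k : ℕ) (f : Fin m → ℂ) :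
    ∫ a, f (a k) ∂(digitMeasure m) = (m : ℂ)⁻¹ * ∑ d, f d := by
  have h := measurePreserving_eval_infinitePi
    (fun _ : ℕ => (PMF.uniformOfFintype (Fin m)).toMeasure) k
  have h1 := PMF.integral_eq_sum (PMF.uniformOfFintype (Fin m)) f
  rw [← h.map_eq, integral_map (measurable_pi_apply k).aemeasurable
    (measurable_of_finite f).aestronglyMeasurable] at h1
  refine h1.trans ?_
  simp [PMF.uniformOfFintype_apply, Finset.mul_sum]

/-- The digit `k` is independent of the previous ones. -/
theorem integral_partial_digitSum_mul_eq_zero (l : ℤ) {Q : ℕ} (hQ : ¬ m ∣ Q) (k : ℕ) :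
    ∫ a, (fourier l ((∑ i ∈ Finset.range k, (a i : ℝ) / (m * M i) : ℝ) : UnitAddCircle)
      * fourier Q (((a k : ℝ) / m : ℝ) : UnitAddCircle) : ℂ) ∂(digitMeasure m) = 0 := by
  -- The integrand factors over the digits `0, …, k`; the factor of the digit `k` has mean zero,
  -- being a full sum of powers of a nontrivial `m`-th root of unity.
  let f (i : ℕ) (d : Fin m) : ℂ := if i = k then fourier Q (((d : ℝ) / m : ℝ) : UnitAddCircle)
    else fourier l (((d : ℝ) / (m * M i) : ℝ) : UnitAddCircle)
  have hprod (a : ℕ → Fin m) :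
      (fourier l ((∑ i ∈ Finset.range k, (a i : ℝ) / (m * M i) : ℝ) : UnitAddCircle)
      * fourier Q (((a k : ℝ) / m : ℝ) : UnitAddCircle) : ℂ)
      = ∏ i : Finset.range (k + 1), f i (a i) := by
    rw [Finset.prod_coe_sort (Finset.range (k + 1)) fun i => f i (a i), Finset.prod_range_succ]
    congr 1
    · have : ∀ i ∈ Finset.range k, f i (a i)
          = fourier l (((a i : ℝ) / (m * M i) : ℝ) : UnitAddCircle) := fun i hi =>
        if_neg (Finset.mem_range.1 hi).ne
      rw [Finset.prod_congr rfl this]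
      simp_rw [fourier_coe_eq]
      rw [← Complex.exp_sum, ← Finset.sum_mul, ← Complex.ofReal_sum, ← Finset.mul_sum,
        ← Finset.mul_sum]
    · simp [f]
  have hind : iIndepFun (fun (i : Finset.range (k + 1)) (a : ℕ → Fin m) => a i) (digitMeasure m) :=
    (iIndepFun_infinitePi (P := fun _ : ℕ => (PMF.uniformOfFintype (Fin m)).toMeasure)
      (X := fun _ x => x) (fun i => measurable_id)).precomp Subtype.val_injective
  simp_rw [hprod]
  rw [hind.integral_fun_prod_comp (f := fun (i : Finset.range (k + 1)) (d : Fin m) => f i d)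
    (fun i => (measurable_pi_apply _).aemeasurable)
    (fun i => (measurable_of_finite _).aestronglyMeasurable)]
  refine Finset.prod_eq_zero (Finset.mem_univ ⟨k, Finset.self_mem_range_succ k⟩) ?_
  rw [integral_digit k (f k)]
  simp only [f, if_true]
  rw [sum_fourier_div_eq_zero hQ, mul_zero]

/-- Measures on the circle whose Fourier coefficients along `Q * M k` behave rigidly or like those
of a mixing system, according to whether `m` divides `Q`. -/
theorem exists_measure_fourier_limits (hm : 2 ≤ m) (hM0 : 0 < M 0)
    (hs : ∀ k, M (k + 1) = M k * s k) (hms : ∀ k, m ∣ s k) (hs0 : ∀ k, m ≤ s k)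
    (hlim : Tendsto s atTop atTop) :
    ∃ σ : Measure UnitAddCircle, IsProbabilityMeasure σ ∧ (∀ x, σ {x} = 0) ∧ ∀ Q : ℕ, ∀ l : ℤ,
      Tendsto (fun k => ∫ x, (fourier (l + (Q * M k : ℕ)) x : ℂ) ∂σ) atTop
        (𝓝 (if m ∣ Q then ∫ x, (fourier l x : ℂ) ∂σ else 0)) := by
  have hX : Measurable fun a : ℕ → Fin m => (digitSum M a : UnitAddCircle) :=
    AddCircle.measurable_mk'.comp (measurable_digitSum hm hM0 hs hs0)
  have hs' : Tendsto (fun k => (s k : ℝ)) atTop atTop := tendsto_natCast_atTop_atTop.comp hlim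
  have hinv : Tendsto (fun k => 2 / (s k : ℝ)) atTop (𝓝 0) := hs'.const_div_atTop 2
  have hinvM : Tendsto (fun k => 2 / (M k : ℝ)) atTop (𝓝 0) := by
    refine Tendsto.const_div_atTop ?_ 2
    refine tendsto_natCast_atTop_atTop.comp (tendsto_atTop_mono (fun k => ?_)
      (tendsto_pow_atTop_atTop_of_one_lt one_lt_two))
    have := mul_two_pow_le hm hs hs0 0 k
    exact (Nat.le_mul_of_pos_left _ hM0).trans this
  have hmeas (n : ℤ) : AEStronglyMeasurable
      (fun a : ℕ → Fin m => (fourier n (digitSum M a : UnitAddCircle) : ℂ)) (digitMeasure m) :=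
    ((fourier n).continuous.measurable.comp hX).aestronglyMeasurable
  have hint (n : ℤ) : Integrable
      (fun a : ℕ → Fin m => (fourier n (digitSum M a : UnitAddCircle) : ℂ)) (digitMeasure m) :=
    Integrable.of_bound (hmeas n) 1 (ae_of_all _ fun x => (norm_fourier_eq_one n _).le)
  have hdig (n : ℤ) (k : ℕ) : AEStronglyMeasurable (fun a : ℕ → Fin m =>
      (fourier n (((a k : ℝ) / m : ℝ) : UnitAddCircle) : ℂ)) (digitMeasure m) :=
    ((measurable_of_finite fun d : Fin m => (fourier n (((d : ℝ) / m : ℝ) : UnitAddCircle) : ℂ)).comp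
      (measurable_pi_apply k)).aestronglyMeasurable
  refine ⟨(digitMeasure m).map fun a => (digitSum M a : UnitAddCircle),
    Measure.isProbabilityMeasure_map hX.aemeasurable, fun x => ?_, fun Q l => ?_⟩
  · rw [Measure.map_apply hX (measurableSet_singleton x)]
    obtain ⟨K, hK⟩ := eventually_atTop.1 (hlim.eventually_gt_atTop (2 * m))
    rcases Set.eq_empty_or_nonempty
      ((fun a : ℕ → Fin m => (digitSum M a : UnitAddCircle)) ⁻¹' {x}) with h | ⟨b, hb⟩
    · rw [h, measure_empty]
    -- All digit sequences over one point of the circle agree from index `K` on.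
    · refine measure_mono_null ?_ (digitMeasure_tail_eq_zero hm K b)
      intro a ha k hk
      exact digit_eq_of_coe_eq hm hM0 hs hms hs0 (Eq.trans ha (Eq.symm hb)) (hK k hk)
  · simp_rw [integral_map hX.aemeasurable (fourier _).continuous.aestronglyMeasurable]
    -- The Fourier coefficient with `M_k x` replaced by `a_k / m`; the error tends to `0` since `s
    -- k` tends to infinity.
    set u : ℕ → ℂ := fun k => ∫ a, (fourier l (digitSum M a : UnitAddCircle)
        * fourier Q (((a k : ℝ) / m : ℝ) : UnitAddCircle) : ℂ) ∂(digitMeasure m) with hu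
    have huint (k : ℕ) : Integrable (fun a : ℕ → Fin m => (fourier l (digitSum M a : UnitAddCircle)
        * fourier Q (((a k : ℝ) / m : ℝ) : UnitAddCircle) : ℂ)) (digitMeasure m) :=
      Integrable.of_bound ((hmeas l).mul (hdig Q k)) 1
        (ae_of_all _ fun x => by rw [norm_mul, norm_fourier_eq_one, norm_fourier_eq_one, one_mul])
    have h1 : Tendsto (fun k => (∫ a, (fourier (l + (Q * M k : ℕ)) (digitSum M a : UnitAddCircle) : ℂ)
        ∂(digitMeasure m)) - u k) atTop (𝓝 0) := by
      have hb : Tendsto (fun k => 2 * Real.pi * (Q * (2 / (s k : ℝ)))) atTop (𝓝 0) := by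
        simpa using (hinv.const_mul (Q : ℝ)).const_mul (2 * Real.pi)
      refine squeeze_zero_norm (fun k => ?_) hb
      rw [hu, ← integral_sub (hint _) (huint k)]
      refine (norm_integral_le_of_norm_le_const (ae_of_all _ fun a =>
        norm_fourier_digitSum_sub_le hm hM0 hs hms hs0 a l Q k)).trans_eq ?_
      simp
    suffices h2 : Tendsto u atTop (𝓝 (if m ∣ Q then
        ∫ a, (fourier l (digitSum M a : UnitAddCircle) : ℂ) ∂(digitMeasure m) else 0)) by
      simpa using h1.add h2
    split_ifs with hQ
    · obtain ⟨c, rfl⟩ := hQ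
      refine tendsto_const_nhds.congr fun k => ?_
      rw [hu]
      refine integral_congr_ae (ae_of_all _ fun a => ?_)
      have h3 : (((m * c : ℕ) : ℤ) • (((a k : ℝ) / m : ℝ) : UnitAddCircle)) = 0 := by
        rw [← AddCircle.coe_zsmul, AddCircle.coe_eq_zero_iff]
        refine ⟨(c * (a k : ℕ) : ℕ), ?_⟩
        have : (m : ℝ) ≠ 0 := by exact_mod_cast NeZero.ne m
        simp only [zsmul_eq_mul]
        push_cast
        field_simp
      simp only [fourier_apply (n := ((m * c : ℕ) : ℤ)), h3]
      simp
    -- When `m` does not divide `Q`, replacing `x` by the sum over its first `k` digits costs `2π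
    -- |l| · 2 / M k`; that sum is independent of `a k`, so the resulting integral is exactly `0`.
    · have hb : Tendsto (fun k => 2 * Real.pi * (|(l : ℝ)| * (2 / (M k : ℝ)))) atTop (𝓝 0) := by
        simpa using (hinvM.const_mul |(l : ℝ)|).const_mul (2 * Real.pi)
      refine squeeze_zero_norm (fun k => ?_) hb
      rw [← sub_zero (u k), ← integral_partial_digitSum_mul_eq_zero (M := M) l hQ k, hu]
      have hpart : AEStronglyMeasurable (fun a : ℕ → Fin m => (fourier l
          ((∑ i ∈ Finset.range k, (a i : ℝ) / (m * M i) : ℝ) : UnitAddCircle) : ℂ))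
          (digitMeasure m) := by
        have : Measurable fun a : ℕ → Fin m => ∑ i ∈ Finset.range k, (a i : ℝ) / (m * M i) :=
          Finset.measurable_fun_sum _ fun i _ =>
            ((measurable_from_top (f := fun x : Fin m => (x : ℝ))).comp
              (measurable_pi_apply i)).div_const _
        exact ((fourier l).continuous.measurable.comp
          (AddCircle.measurable_mk'.comp this)).aestronglyMeasurable
      have hpint : Integrable (fun a : ℕ → Fin m => (fourier l
          ((∑ i ∈ Finset.range k, (a i : ℝ) / (m * M i) : ℝ) : UnitAddCircle)
            * fourier Q (((a k : ℝ) / m : ℝ) : UnitAddCircle) : ℂ)) (digitMeasure m) :=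
        Integrable.of_bound (hpart.mul (hdig Q k)) 1
          (ae_of_all _ fun x => by rw [norm_mul, norm_fourier_eq_one, norm_fourier_eq_one, one_mul])
      rw [← integral_sub (huint k) hpint]
      refine (norm_integral_le_of_norm_le_const (C := 2 * Real.pi * (|(l : ℝ)| * (2 / (M k : ℝ))))
        (ae_of_all _ fun a => ?_)).trans_eq (by simp)
      rw [← sub_mul, norm_mul, norm_fourier_eq_one, mul_one]
      refine (norm_fourier_coe_sub_le _ _ _ _).trans ?_
      rw [← mul_sub, abs_mul]
      obtain ⟨h3, h4⟩ := digitSum_sub_mem hm hM0 hs hs0 a k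
      rw [abs_of_nonneg h3]
      gcongr

end DigitMeasure

/-! ### Isomorphism of atomless measures with Lebesgue measure -/

section UniformTransform

theorem continuous_cdf (ν : Measure ℝ) [IsProbabilityMeasure ν] (hν : ∀ t, ν {t} = 0) :
    Continuous (cdf ν) := by
  rw [continuous_iff_continuousAt]
  intro t
  have h1 := (cdf ν).measure_singleton t
  rw [measure_cdf, hν, eq_comm, ENNReal.ofReal_eq_zero, sub_nonpos] at h1
  rw [(monotone_cdf ν).continuousAt_iff_leftLim_eq_rightLim, (cdf ν).rightLim_eq]
  exact le_antisymm ((monotone_cdf ν).leftLim_le le_rfl) h1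

/-- If non-empty, the sublevel set is a half-line `(-∞, b]`, bounded because `c < 1`, and continuity
of the distribution function forces its value at `b` to be `c`. -/
theorem measure_cdf_le (ν : Measure ℝ) [IsProbabilityMeasure ν] (hν : ∀ t, ν {t} = 0) {c : ℝ}
    (h1 : c < 1) : ν {t | cdf ν t ≤ c} = ENNReal.ofReal c := by
  have hcont := continuous_cdf ν hν
  have hmono := monotone_cdf ν
  rcases Set.eq_empty_or_nonempty {t | cdf ν t ≤ c} with he | hne
  · have h2 : c ≤ 0 := by
      refine ge_of_tendsto' (tendsto_cdf_atBot ν) fun t => ?_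
      by_contra! h3
      exact (he ▸ (h3.le : t ∈ {t | cdf ν t ≤ c}) : t ∈ (∅ : Set ℝ))
    rw [he, measure_empty, ENNReal.ofReal_of_nonpos h2]
  have hbdd : BddAbove {t | cdf ν t ≤ c} := by
    obtain ⟨b, hb⟩ := ((tendsto_cdf_atTop ν).eventually_const_lt h1).exists
    refine ⟨b, fun t ht => ?_⟩
    by_contra! h3
    exact absurd ((hmono h3.le).trans ht) (not_le.2 hb)
  have hcl : IsClosed {t | cdf ν t ≤ c} := isClosed_le hcont continuous_const
  set b := sSup {t | cdf ν t ≤ c} with hb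
  have hbm : cdf ν b ≤ c := hcl.csSup_mem hne hbdd
  have hset : {t | cdf ν t ≤ c} = Set.Iic b := by
    ext t
    exact ⟨fun ht => le_csSup hbdd ht, fun ht => (hmono ht).trans hbm⟩
  have hbc : cdf ν b = c := by
    refine le_antisymm hbm ?_
    refine ge_of_tendsto (hcont.continuousAt.tendsto.mono_left nhdsWithin_le_nhds :
      Tendsto (cdf ν) (𝓝[>] b) (𝓝 (cdf ν b))) ?_
    filter_upwards [self_mem_nhdsWithin] with t ht
    by_contra! h3
    exact absurd (le_csSup hbdd (show t ∈ {t | cdf ν t ≤ c} from h3.le)) (not_le.2 ht)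
  rw [hset, ← ofReal_cdf, hbc]

theorem map_cdf (ν : Measure ℝ) [IsProbabilityMeasure ν] (hν : ∀ t, ν {t} = 0) :
    ν.map (cdf ν) = volume.restrict (Set.Icc 0 1) := by
  have hm : Measurable (cdf ν) := (monotone_cdf ν).measurable
  have := Measure.isProbabilityMeasure_map (μ := ν) hm.aemeasurable
  refine Measure.ext_of_Iic _ _ fun c => ?_
  rw [Measure.map_apply hm measurableSet_Iic, Measure.restrict_apply measurableSet_Iic]
  change ν {t | cdf ν t ≤ c} = _
  rcases lt_or_ge c 0 with h0 | h0
  · have h2 : {t | cdf ν t ≤ c} = ∅ :=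
      Set.eq_empty_of_forall_notMem fun t ht => absurd ((cdf_nonneg ν t).trans ht) (not_le.2 h0)
    have h3 : Set.Iic c ∩ Set.Icc 0 1 = ∅ :=
      Set.eq_empty_of_forall_notMem fun t ht => absurd (ht.2.1.trans ht.1) (not_le.2 h0)
    rw [h2, h3, measure_empty, measure_empty]
  rcases lt_or_ge c 1 with h1 | h1
  · rw [measure_cdf_le ν hν h1]
    have h3 : Set.Iic c ∩ Set.Icc 0 1 = Set.Icc 0 c := by
      ext t
      exact ⟨fun ht => ⟨ht.2.1, ht.1⟩, fun ht => ⟨ht.2, ht.1, ht.2.trans h1.le⟩⟩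
    rw [h3, Real.volume_Icc, sub_zero]
  · have h2 : {t | cdf ν t ≤ c} = Set.univ :=
      Set.eq_univ_of_forall fun t => (cdf_le_one ν t).trans h1
    have h3 : Set.Iic c ∩ Set.Icc 0 1 = Set.Icc 0 1 :=
      Set.inter_eq_right.2 fun t ht => ht.2.trans h1
    rw [h2, h3, measure_univ, Real.volume_Icc]
    simp

/-- A probability measure without atoms on a standard Borel space is isomorphic, up to null sets,
to Lebesgue measure on the unit interval. -/
theorem exists_map_eq_volume_injOn {X : Type*} [MeasurableSpace X] [StandardBorelSpace X]
    (γ : Measure X) [IsProbabilityMeasure γ] (hγ : ∀ x, γ {x} = 0) :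
    ∃ g : X → Set.Icc (0 : ℝ) 1, MeasurePreserving g γ volume ∧
      ∃ s : Set X, MeasurableSet s ∧ γ sᶜ = 0 ∧ Set.InjOn g s := by
  have he := measurableEmbedding_embeddingReal X
  set e := embeddingReal X
  set ν := γ.map e with hν
  have : IsProbabilityMeasure ν := Measure.isProbabilityMeasure_map he.measurable.aemeasurable
  have hν0 (t : ℝ) : ν {t} = 0 := by
    rw [hν, Measure.map_apply he.measurable (measurableSet_singleton t)]
    rcases Set.eq_empty_or_nonempty (e ⁻¹' {t}) with h | ⟨x, hx⟩
    · rw [h, measure_empty]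
    · refine measure_mono_null ?_ (hγ x)
      intro y hy
      exact he.injective (Eq.trans hy (Eq.symm hx))
  have hF : Measurable (cdf ν) := (monotone_cdf ν).measurable
  let G (t : ℝ) : Set.Icc (0 : ℝ) 1 := ⟨cdf ν t, cdf_nonneg ν t, cdf_le_one ν t⟩
  have hG : Measurable G := hF.subtype_mk
  have hGν : ν.map G = volume := by
    have h1 := map_cdf ν hν0
    have h2 : (ν.map G).map ((↑) : Set.Icc (0 : ℝ) 1 → ℝ) =
        (volume : Measure (Set.Icc (0 : ℝ) 1)).map (↑) := by
      rw [Measure.map_map measurable_subtype_coe hG]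
      exact h1.trans (map_comap_subtype_coe measurableSet_Icc volume).symm
    rw [← (MeasurableEmbedding.subtype_coe measurableSet_Icc).comap_map (ν.map G), h2,
      (MeasurableEmbedding.subtype_coe measurableSet_Icc).comap_map]
  have hmp : MeasurePreserving (fun x => G (e x)) γ volume := by
    refine ⟨hG.comp he.measurable, ?_⟩
    rw [← hGν, hν, Measure.map_map hG he.measurable]
    rfl
  -- The good set consists of the points to the right of whose image the distribution function
  -- increases at once. For each rational `q`, the points violating this lie in one fibre of `G ∘
  -- e`, which is null.
  refine ⟨fun x => G (e x), hmp,
    ⋂ q : ℚ, {x | e x < q → cdf ν (e x) < cdf ν q}, ?_, ?_, ?_⟩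
  · refine MeasurableSet.iInter fun q => ?_
    have h1 : MeasurableSet {x | e x < q} := measurableSet_lt he.measurable measurable_const
    have h2 : MeasurableSet {x | cdf ν (e x) < cdf ν q} :=
      measurableSet_lt (hF.comp he.measurable) measurable_const
    have h3 : {x | e x < q → cdf ν (e x) < cdf ν q} = {x | e x < q}ᶜ ∪ {x | cdf ν (e x) < cdf ν q} := by
      ext x
      exact imp_iff_not_or
    rw [h3]
    exact h1.compl.union h2
  · rw [Set.compl_iInter, measure_iUnion_null_iff]
    intro q
    have h1 : γ ((fun x => G (e x)) ⁻¹' {G q}) = 0 := by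
      rw [hmp.measure_preimage (measurableSet_singleton _).nullMeasurableSet]
      exact measure_singleton _
    refine measure_mono_null ?_ h1
    intro x hx
    have h2 : ¬ (e x < q → cdf ν (e x) < cdf ν q) := hx
    push Not at h2
    exact Subtype.ext (le_antisymm (monotone_cdf ν h2.1.le) h2.2)
  · intro x hx y hy hxy
    have h1 : cdf ν (e x) = cdf ν (e y) := congrArg Subtype.val hxy
    have key : ∀ x y : X, x ∈ ⋂ q : ℚ, {x | e x < q → cdf ν (e x) < cdf ν q} →
        cdf ν (e x) = cdf ν (e y) → ¬ e x < e y := by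
      intro x y hx h h2
      obtain ⟨q, hq1, hq2⟩ := exists_rat_btwn h2
      have h3 : cdf ν (e x) < cdf ν q := Set.mem_iInter.1 hx q hq1
      exact absurd (h3.trans_le (monotone_cdf ν hq2.le)) (by rw [h]; exact lt_irrefl _)
    exact he.injective (le_antisymm (not_lt.1 (key y x hy h1.symm)) (not_lt.1 (key x y hx h1)))

end UniformTransform

/-! ### Transport of a transformation to the unit interval -/

section Transport

variable {X : Type*} [MeasurableSpace X]

theorem power_zero (T : X ≃ᵐ X) (x : X) : CondC.power T 0 x = x := by simp [CondC.power]

theorem power_add_one (T : X ≃ᵐ X) (n : ℤ) (x : X) :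
    CondC.power T (n + 1) x = T (CondC.power T n x) := by
  rw [CondC.power, add_comm, zpow_one_add, Equiv.Perm.mul_apply]
  rfl

theorem power_sub_one (T : X ≃ᵐ X) (n : ℤ) (x : X) :
    CondC.power T (n - 1) x = T.symm (CondC.power T n x) := by
  rw [CondC.power, sub_eq_add_neg, add_comm, zpow_add, zpow_neg_one, Equiv.Perm.mul_apply]
  rfl

theorem power_one_add (T : X ≃ᵐ X) (n : ℤ) (x : X) :
    CondC.power T (1 + n) x = CondC.power T n (T x) := by
  rw [CondC.power, add_comm, zpow_add_one, Equiv.Perm.mul_apply]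
  rfl

theorem measurable_power (T : X ≃ᵐ X) (n : ℤ) : Measurable (CondC.power T n) := by
  induction n using Int.induction_on with
  | zero =>
    rw [show CondC.power T 0 = id from funext (power_zero T)]
    exact measurable_id
  | succ k ih =>
    rw [show CondC.power T (k + 1) = T ∘ CondC.power T k from funext (power_add_one T k)]
    exact T.measurable.comp ih
  | pred k ih =>
    rw [show CondC.power T (-k - 1) = T.symm ∘ CondC.power T (-k) from funext (power_sub_one T _)]
    exact T.symm.measurable.comp ih

theorem MeasureTheory.MeasurePreserving.power {γ : Measure X} {T : X ≃ᵐ X}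
    (hT : MeasurePreserving T γ γ) (n : ℤ) : MeasurePreserving (CondC.power T n) γ γ := by
  induction n using Int.induction_on with
  | zero =>
    rw [show CondC.power T 0 = id from funext (power_zero T)]
    exact MeasurePreserving.id γ
  | succ k ih =>
    rw [show CondC.power T (k + 1) = T ∘ CondC.power T k from funext (power_add_one T k)]
    exact hT.comp ih
  | pred k ih =>
    rw [show CondC.power T (-k - 1) = T.symm ∘ CondC.power T (-k) from funext (power_sub_one T _)]
    exact (hT.symm T).comp ih

/-- The largest invariant subset. -/
def invariantCore (T : X ≃ᵐ X) (s : Set X) : Set X := ⋂ n : ℤ, CondC.power T n ⁻¹' s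

theorem apply_mem_invariantCore {T : X ≃ᵐ X} {s : Set X} {x : X} :
    T x ∈ invariantCore T s ↔ x ∈ invariantCore T s := by
  simp only [invariantCore, Set.mem_iInter, Set.mem_preimage, ← power_one_add]
  refine ⟨fun h n => ?_, fun h n => h _⟩
  simpa using h (n - 1)

theorem power_mem_invariantCore {T : X ≃ᵐ X} {s : Set X} {x : X} (n : ℤ)
    (hx : x ∈ invariantCore T s) : CondC.power T n x ∈ invariantCore T s := by
  induction n using Int.induction_on with
  | zero => rwa [power_zero]
  | succ k ih => rwa [power_add_one, apply_mem_invariantCore]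
  | pred k ih =>
    rw [power_sub_one, ← apply_mem_invariantCore, T.apply_symm_apply]
    exact ih

theorem invariantCore_subset (T : X ≃ᵐ X) (s : Set X) : invariantCore T s ⊆ s := fun x hx => by
  simpa [power_zero] using Set.mem_iInter.1 hx 0

theorem measurableSet_invariantCore (T : X ≃ᵐ X) {s : Set X} (hs : MeasurableSet s) :
    MeasurableSet (invariantCore T s) :=
  MeasurableSet.iInter fun n => measurable_power T n hs

theorem measure_invariantCore_compl {γ : Measure X} {T : X ≃ᵐ X} (hT : MeasurePreserving T γ γ)
    {s : Set X} (hs : MeasurableSet s) (h0 : γ sᶜ = 0) : γ (invariantCore T s)ᶜ = 0 := by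
  rw [invariantCore, Set.compl_iInter, measure_iUnion_null_iff]
  intro n
  rw [← Set.preimage_compl, (hT.power n).measure_preimage hs.compl.nullMeasurableSet, h0]

/-- Conjugation of a transformation by a map that is injective on an invariant set. -/
theorem exists_conjugate [StandardBorelSpace X] {Y : Type*} [MeasurableSpace Y]
    [StandardBorelSpace Y] (T : X ≃ᵐ X) {s : Set X} (hs : MeasurableSet s)
    (hTs : ∀ x, T x ∈ s ↔ x ∈ s) {g : X → Y} (hg : Measurable g) (hinj : Set.InjOn g s) :
    ∃ S : Y ≃ᵐ Y, ∀ x ∈ s, S (g x) = g (T x) := by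
  classical
  have := hs.standardBorel
  -- By Lusin–Souslin, an injective Borel map between standard Borel spaces has Borel image and
  -- Borel inverse; the conjugate can thus be extended by the identity off the image.
  have hgs : MeasurableEmbedding (s.domRestrict g) :=
    (hg.comp measurable_subtype_coe).measurableEmbedding (Set.injOn_iff_injective.1 hinj)
  let T1 : s ≃ᵐ s :=
    { toEquiv := T.toEquiv.subtypeEquiv fun x => (hTs x).symm
      measurable_toFun := (T.measurable.comp measurable_subtype_coe).subtype_mk
      measurable_invFun := (T.symm.measurable.comp measurable_subtype_coe).subtype_mk }
  let S1 : Set.range (s.domRestrict g) ≃ᵐ Set.range (s.domRestrict g) :=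
    hgs.equivRange.symm.trans (T1.trans hgs.equivRange)
  let c := MeasurableEquiv.sumCompl hgs.measurableSet_range
  have hc (y : Set.range (s.domRestrict g)) : c (Sum.inl y) = y := rfl
  refine ⟨c.symm.trans ((MeasurableEquiv.sumCongr S1 (MeasurableEquiv.refl _)).trans c),
    fun x hx => ?_⟩
  have h1 : c.symm (g x) = Sum.inl (hgs.equivRange ⟨x, hx⟩) := by
    rw [MeasurableEquiv.symm_apply_eq, hc, MeasurableEmbedding.equivRange_apply]
    rfl
  have h2 : S1 (hgs.equivRange ⟨x, hx⟩) = hgs.equivRange (T1 ⟨x, hx⟩) := by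
    change hgs.equivRange (T1 (hgs.equivRange.symm (hgs.equivRange _))) = _
    rw [MeasurableEquiv.symm_apply_apply]
  rw [MeasurableEquiv.trans_apply, MeasurableEquiv.trans_apply, h1]
  change c (Sum.inl (S1 _)) = _
  rw [h2, hc, MeasurableEmbedding.equivRange_apply]
  rfl

/-- The map `g` is injective only on a conull set. Its invariant core is still conull, being a
countable intersection of preimages under powers of `T`, and there `g` conjugates all powers; the
properties in question ignore null sets. -/
theorem exists_conjugate_on_unitInterval [StandardBorelSpace X] (γ : Measure X)
    [IsProbabilityMeasure γ] (hγ : ∀ x, γ {x} = 0) {T : X ≃ᵐ X} (hT : MeasurePreserving T γ γ)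
    (hap : CondC.Aperiodic γ T) :
    ∃ S : Set.Icc (0 : ℝ) 1 ≃ᵐ Set.Icc (0 : ℝ) 1, MeasurePreserving S volume volume ∧
      CondC.Aperiodic volume S ∧
      ∀ (a : ℕ → ℤ) (ξ : ℝ), CondC.LimitAlong γ T a ξ → CondC.LimitAlong volume S a ξ := by
  obtain ⟨g, hg, s, hs, hs0, hinj⟩ := exists_map_eq_volume_injOn γ hγ
  set t := invariantCore T s with ht
  have htm : MeasurableSet t := measurableSet_invariantCore T hs
  have ht0 : γ tᶜ = 0 := measure_invariantCore_compl hT hs hs0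
  have htae : ∀ᵐ x ∂γ, x ∈ t := ht0
  have htinj : Set.InjOn g t := hinj.mono (invariantCore_subset T s)
  obtain ⟨S, hS⟩ := exists_conjugate T htm (fun x => apply_mem_invariantCore) hg.measurable htinj
  have hpow (n : ℤ) : ∀ x ∈ t, CondC.power S n (g x) = g (CondC.power T n x) := by
    intro x hx
    induction n using Int.induction_on with
    | zero => rw [power_zero, power_zero]
    | succ k ih => rw [power_add_one, power_add_one, ih, hS _ (power_mem_invariantCore _ hx)]
    | pred k ih =>
      rw [power_sub_one, power_sub_one, ih, S.symm_apply_eq, hS, T.apply_symm_apply]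
      rw [← power_sub_one]
      exact power_mem_invariantCore _ hx
  refine ⟨S, ⟨S.measurable, ?_⟩, ?_, fun a ξ h A B hA hB => ?_⟩
  · nth_rw 1 [← hg.map_eq]
    rw [Measure.map_map S.measurable hg.measurable, ← hg.map_eq]
    nth_rw 2 [← hT.map_eq]
    rw [Measure.map_map hg.measurable T.measurable]
    refine Measure.map_congr ?_
    filter_upwards [htae] with x hx
    exact hS x hx
  · have hset : {y | ∃ n : ℕ, 1 ≤ n ∧ CondC.power S (n : ℤ) y = y}
        = ⋃ n : ℕ, ⋃ _ : 1 ≤ n, {y | CondC.power S (n : ℤ) y = y} := by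
      ext y
      simp
    have hm : MeasurableSet {y | ∃ n : ℕ, 1 ≤ n ∧ CondC.power S (n : ℤ) y = y} := by
      rw [hset]
      exact MeasurableSet.iUnion fun n => MeasurableSet.iUnion fun _ =>
        measurableSet_eq_fun (measurable_power S n) measurable_id
    rw [CondC.Aperiodic, ← hg.measure_preimage hm.nullMeasurableSet]
    refine measure_mono_null ?_ (measure_union_null hap ht0)
    rintro x ⟨n, hn, hx⟩
    by_cases hxt : x ∈ t
    · refine Or.inl ⟨n, hn, htinj (power_mem_invariantCore _ hxt) hxt ?_⟩
      rw [← hpow n x hxt, hx]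
    · exact Or.inr hxt
  · have hr {C : Set (Set.Icc (0 : ℝ) 1)} (hC : MeasurableSet C) :
        volume.real C = γ.real (g ⁻¹' C) := by
      rw [measureReal_def, measureReal_def, hg.measure_preimage hC.nullMeasurableSet]
    have h1 := h (g ⁻¹' A) (g ⁻¹' B) (hg.measurable hA) (hg.measurable hB)
    rw [hr hA, hr hB, hr (hA.inter hB)]
    refine h1.congr fun k => ?_
    rw [hr (hA.inter (measurable_power S (a k) hB))]
    refine measureReal_congr ?_
    filter_upwards [htae] with x hx
    refine propext (and_congr Iff.rfl ?_)
    change g (CondC.power T (a k) x) ∈ B ↔ CondC.power S (a k) (g x) ∈ B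
    rw [hpow _ x hx]

end Transport

/-! ### Choice of the modulus and the sequence -/

section PrimeProducts

/-- The digit construction with `M_k = c R^k k!`: the ratios `R (k + 1)` are multiples of every
divisor `m` of `R` and are unbounded, so the same sequence serves all such `m`. -/
theorem exists_gaussian_system_of_dvd {N m R c : ℕ} (hm : 2 ≤ m) (hmR : m ∣ R) (hR : 0 < R)
    (hc : 0 < c) (Q : Fin N → ℕ) (ξ : Fin N → Fin 2) (hQ : ∀ j, m ∣ Q j ↔ ξ j = 0) :
    ∃ γ : Measure (ℤ → ℝ), IsProbabilityMeasure γ ∧ CondC.IsNontrivialGaussianSystem γ ∧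
      CondC.WeaklyMixing γ CondC.shift ∧ CondC.Aperiodic γ CondC.shift ∧ (∀ ω, γ {ω} = 0) ∧
      ∀ j, CondC.LimitAlong γ CondC.shift
        (fun k => ((Q j * (c * (R ^ k * k.factorial)) : ℕ) : ℤ)) ((ξ j : ℕ) : ℝ) := by
  have : NeZero m := ⟨by omega⟩
  have hms (k : ℕ) : m ∣ R * (k + 1) := hmR.mul_right _
  have hpos (k : ℕ) : 0 < R * (k + 1) := by positivity
  obtain ⟨σ, hσ1, hσ0, hσ⟩ := exists_measure_fourier_limits (m := m)
    (M := fun k => c * (R ^ k * k.factorial)) (s := fun k => R * (k + 1)) hm (by simpa using hc)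
    (fun k => by rw [Nat.factorial_succ]; ring) hms (fun k => Nat.le_of_dvd (hpos k) (hms k))
    (tendsto_atTop_mono (fun k => (Nat.le_succ k).trans (Nat.le_mul_of_pos_left _ hR)) tendsto_id)
  obtain ⟨γ, hγ, h1, h2, h3, h4, h5⟩ := exists_gaussian_system σ hσ0 (IsProbabilityMeasure.ne_zero σ)
  refine ⟨γ, hγ, h1, h2, h3, h4, fun j => h5 _ _ ?_ fun l => ?_⟩
  · rcases (by omega : ξ j = 0 ∨ ξ j = 1) with h | h <;> simp [h]
  · have h6 := hσ (Q j) l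
    convert h6 using 2
    by_cases h7 : ξ j = 0
    · simp [h7, (hQ j).2 h7]
    · have h8 : ξ j = 1 := by omega
      rw [if_neg (fun h => h7 ((hQ j).1 h)), h8]
      simp

variable {N I : ℕ} {A : Fin I → Finset (Fin N)} {p : Fin I → ℕ}

theorem prime_dvd_prod_iff (hp : ∀ i, (p i).Prime) (hp_inj : Function.Injective p) (i : Fin I)
    (j : Fin N) : p i ∣ ∏ i' with j ∈ A i', p i' ↔ j ∈ A i := by
  refine ⟨fun h => ?_, fun h => Finset.dvd_prod_of_mem p (by simpa using h)⟩
  obtain ⟨i', hi', h'⟩ := (hp i).prime.exists_mem_finset_dvd h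
  have := hp_inj ((Nat.prime_dvd_prime_iff_eq (hp i) (hp i')).1 h')
  subst this
  simpa using hi'

theorem exists_gaussian_system_of_pattern
    (hA : ∀ S : Finset (Fin N), S.Nonempty → S ≠ Finset.univ → ∃ i, A i = S)
    (hp : ∀ i, (p i).Prime) (hp_inj : Function.Injective p) (q : Fin N → ℕ)
    (hq : ∀ j, q j = ∏ i with j ∈ A i, p i) (ξ : Fin N → Fin 2) :
    ∃ γ : Measure (ℤ → ℝ), IsProbabilityMeasure γ ∧ CondC.IsNontrivialGaussianSystem γ ∧
      CondC.WeaklyMixing γ CondC.shift ∧ CondC.Aperiodic γ CondC.shift ∧ (∀ ω, γ {ω} = 0) ∧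
      ∀ j, CondC.LimitAlong γ CondC.shift
        (fun k => ((q j * (2 * ((2 * ∏ i, p i) ^ k * k.factorial)) : ℕ) : ℤ))
        ((ξ j : ℕ) : ℝ) := by
  have hP : 0 < ∏ i, p i := Finset.prod_pos fun i _ => (hp i).pos
  set R := 2 * ∏ i, p i with hR
  have hR0 : 0 < R := by positivity
  rcases Finset.eq_empty_or_nonempty (Finset.univ.filter fun j => ξ j = 0) with hS | hS
  -- Mixing along every `φ_j`: no `q j` is divisible by `R`, since `0 < q j ≤ ∏ p_i < R`.
  · refine exists_gaussian_system_of_dvd (m := R) (by omega) dvd_rfl hR0 two_pos q ξ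
      fun j => ⟨fun h => ?_, fun h => ?_⟩
    · have h1 : 0 < q j := by rw [hq]; exact Finset.prod_pos fun i _ => (hp i).pos
      have h2 : q j ≤ ∏ i, p i := by
        rw [hq]
        exact Finset.prod_le_prod_of_subset_of_one_le' (Finset.filter_subset _ _)
          fun i _ _ => (hp i).one_le
      have := Nat.le_of_dvd h1 h
      omega
    · have := Finset.filter_eq_empty_iff.1 hS (Finset.mem_univ j)
      exact absurd h this
  by_cases hU : (Finset.univ.filter fun j => ξ j = 0) = Finset.univ
  -- Rigidity along every `φ_j`: the leading factor `2` of the sequence is moved into `Q j = 2 * q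
  -- j`, so that `m = 2` divides every `Q j`.
  · obtain ⟨γ, h1, h2, h3, h4, h5, h6⟩ := exists_gaussian_system_of_dvd (m := 2) (R := R) le_rfl
      (Dvd.intro _ rfl) hR0 one_pos (fun j => 2 * q j) ξ
      (fun j => iff_of_true (Dvd.intro _ rfl) (Finset.filter_eq_self.1 hU j (Finset.mem_univ j)))
    refine ⟨γ, h1, h2, h3, h4, h5, fun j => ?_⟩
    convert h6 j using 3
    ring
  -- The rigid indices form some `A i`, and `p i` divides `q j` exactly for `j ∈ A i`.
  · obtain ⟨i, hi⟩ := hA _ hS hU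
    refine exists_gaussian_system_of_dvd (m := p i) (hp i).two_le
      ((Finset.dvd_prod_of_mem p (Finset.mem_univ i)).mul_left _) hR0 two_pos q ξ fun j => ?_
    rw [hq, prime_dvd_prod_iff hp hp_inj, hi]
    simp

/-- The relation `q_1 φ_0 - q_0 φ_1 = 0`, with indices counted from zero, is a nontrivial integer
combination that vanishes identically. -/
theorem not_asymptoticallyIndependent_of_linear (hN : 2 ≤ N) {q : Fin N → ℕ} (hq : ∀ j, q j ≠ 0)
    {φ : Fin N → ℕ → ℤ} (hφ : ∀ j k, φ j k = (q j : ℤ) * (k : ℤ)) :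
    ¬ CondC.AsymptoticallyIndependent φ := by
  intro h
  let i : Fin N := ⟨0, by omega⟩
  let j : Fin N := ⟨1, by omega⟩
  have hij : i ≠ j := by simp [i, j]
  let a : Fin N → ℤ := Pi.single i (q j : ℤ) - Pi.single j (q i : ℤ)
  have ha : a ≠ 0 := by
    intro h0
    have := congrFun h0 i
    simp [a, hij, hq j] at this
  have h1 (k : ℕ) : |∑ l, a l * φ l k| = 0 := by
    simp only [a, Pi.sub_apply, sub_mul, Finset.sum_sub_distrib, Pi.single_apply, ite_mul, zero_mul,
      Finset.sum_ite_eq', Finset.mem_univ, if_true, hφ]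
    rw [abs_eq_zero]
    ring
  have h2 := h a ha
  simp_rw [h1] at h2
  exact not_tendsto_const_atTop _ _ h2

end PrimeProducts

/-! ### The main theorem -/

theorem mainTheorem7 (N : ℕ) (hN : 2 ≤ N)
    (A : Fin (2 ^ N - 2) → Finset (Fin N)) (hA_inj : Function.Injective A)
    (hA : ∀ S : Finset (Fin N), (∃ i, A i = S) ↔ (S.Nonempty ∧ S ≠ Finset.univ))
    (p : Fin (2 ^ N - 2) → ℕ) (hp : ∀ i, (p i).Prime) (hp_inj : Function.Injective p)
    (q : Fin N → ℕ) (hq : ∀ j, q j = ∏ i with j ∈ A i, p i)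
    (φ : Fin N → ℕ → ℤ) (hφ : ∀ j k, φ j k = (q j : ℤ) * (k : ℤ)) :
    (∃ n : ℕ → ℕ, CondC.IsIncreasingSeq n ∧
      (∀ ξ : Fin N → Fin 2, ∃ γ : Measure (ℤ → ℝ),
        CondC.IsNontrivialGaussianSystem γ ∧ CondC.WeaklyMixing γ CondC.shift ∧
        ∀ j, CondC.LimitAlong γ CondC.shift (fun k => φ j (n k)) ((ξ j : ℕ) : ℝ)) ∧
      CondC.WitnessesConditionC φ n) ∧
    CondC.ConditionC φ ∧
    ¬ CondC.AsymptoticallyIndependent φ := by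
  have hA' : ∀ S : Finset (Fin N), S.Nonempty → S ≠ Finset.univ → ∃ i, A i = S :=
    fun S h1 h2 => (hA S).2 ⟨h1, h2⟩
  have hP : 0 < ∏ i, p i := Finset.prod_pos fun i _ => (hp i).pos
  -- Independent of `ξ`: the power makes the ratios divisible by every modulus used, the factorial
  -- makes them unbounded, and the leading `2` serves the pattern `ξ = 0`.
  set n : ℕ → ℕ := fun k => 2 * ((2 * ∏ i, p i) ^ k * k.factorial) with hn
  have hpos (k : ℕ) : 0 < n k := by positivity
  have hinc : CondC.IsIncreasingSeq n := by
    refine ⟨strictMono_nat_of_lt_succ fun k => ?_, hpos⟩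
    have h1 : n (k + 1) = n k * (2 * ((∏ i, p i) * (k + 1))) := by
      simp only [hn, Nat.factorial_succ]
      ring
    have h2 : 0 < (∏ i, p i) * (k + 1) := by positivity
    rw [h1]
    exact lt_mul_of_one_lt_right (hpos k) (by omega)
  have hφn (j : Fin N) : (fun k => φ j (n k)) = fun k => ((q j * n k : ℕ) : ℤ) := by
    funext k
    exact (hφ _ _).trans (Nat.cast_mul _ _).symm
  have hsys := exists_gaussian_system_of_pattern hA' hp hp_inj q hq
  have hwit : CondC.WitnessesConditionC φ n := by
    intro ξ
    obtain ⟨γ, h1, -, h3, h4, h5, h6⟩ := hsys ξ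
    obtain ⟨S, hS, hap, hlim⟩ := exists_conjugate_on_unitInterval γ h5 h3.1 h4
    exact ⟨S, hS, hap, fun j => hlim _ _ (by rw [hφn]; exact h6 j)⟩
  refine ⟨⟨n, hinc, fun ξ => ?_, hwit⟩, ⟨n, hinc, hwit⟩,
    not_asymptoticallyIndependent_of_linear hN (fun j => ?_) hφ⟩
  · obtain ⟨γ, -, h2, h3, -, -, h6⟩ := hsys ξ
    exact ⟨γ, h2, h3, fun j => by rw [hφn]; exact h6 j⟩
  · rw [hq]
    exact (Finset.prod_pos fun i _ => (hp i).pos).ne'
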